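/- Graphs are finite and have at least one vertex. A family of graphs is minor-closed if it contains every graph obtained from one of its members by edge deletions and edge contractions, and nontrivial if it omits at least one graph. For a connected graph $G=(V,E)$ with nonnegative edge weights let $\mathrm{dist}(u,v)$ be the length of a shortest $u$-to-$v$ path. Given a set $F\subseteq V$ of allowed facility locations (for example $F=V$), a nonempty set $C\subseteq V$ of clients, an opening cost $f>0$ and an exponent $p>0$, put $$\mathrm{cost}(S)=f|S|+\sum_{c\in C}\Bigl(\min_{u\in S}\mathrm{dist}(c,u)\Bigr)^p\qquad(\emptyset\ne S\subseteq F).$$ Given $\varepsilon>0$ and integers $n\ge 2$ and $s\ge 0$, local search starts with an arbitrary nonempty $S\subseteq F$; while there is a nonempty $S'\subseteq F$ with $|S\setminus S'|+|S'\setminus S|\le s$ and $\mathrm{cost}(S')\le(1-\varepsilon/n)\,\mathrm{cost}(S)$, it replaces $S$ by some such $S'$; then it outputs $S$. **Theorem.** Let $\mathcal K$ be a nontrivial minor-closed family of graphs. There is a constant $c$, depending only on $\mathcal K$, such that for all real $p>0$ and $0<\varepsilon<1/2$ and every integer $s\ge\lfloor 1/\varepsilon^{c}\rfloor$ the following holds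 for every connected $G\in\mathcal K$, all nonnegative edge weights, all $F\subseteq V$, all nonempty $C\subseteq V$, all $f>0$ and every integer $n\ge\max(|C|,2)$ (in particular for $n=|C|$ if $|C|\ge2$, and for $n=|V|$ if $|V|\ge2$): local search terminates, and every possible output $L$ with $|L|\le n$ satisfies $$\mathrm{cost}(L)\le(1+\varepsilon)\,\mathrm{cost}(S)\quad\text{for every nonempty } S\subseteq F.$$ Moreover, for $p=1$ there is a constant $c$, depending only on $\mathcal K$, such that the same conclusion holds for all $0<\varepsilon<1/2$ and every integer $s\ge\lfloor c/\varepsilon^{2}\rfloor$. -/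

import Mathlib

universe u

noncomputable section

namespace MinorFacility

/-- `IsMinor H G`: the graph `H` is obtained from `G` by edge contractions and edge deletions.
The map `φ` sends a vertex of `G` to the vertex of `H` into which it is contracted: every fibre is
connected in `G` (and nonempty), and every edge of `H` comes from an edge of `G`.
No vertex is deleted here. Being closed under these operations is therefore a weaker requirement
on a family of graphs than being closed under vertex deletions as well. -/
def IsMinor {W V : Type u} (H : SimpleGraph W) (G : SimpleGraph V) : Prop :=
  ∃ φ : V → W, (∀ a : W, (G.induce {x : V | φ x = a}).Connected) ∧
    ∀ a b : W, H.Adj a b → ∃ x y : V, φ x = a ∧ φ y = b ∧ G.Adj x y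

/-- A family of graphs is minor-closed if it contains every minor of each of its (finite)
members. In particular it is closed under isomorphism. -/
def MinorClosed (K : (V : Type u) → SimpleGraph V → Prop) : Prop :=
  ∀ (V W : Type u) [Finite V] [Finite W] (G : SimpleGraph V) (H : SimpleGraph W),
    K V G → IsMinor H G → K W H

/-- A family of graphs is nontrivial if it omits at least one finite graph
(graphs have at least one vertex). -/
def NontrivialFamily (K : (V : Type u) → SimpleGraph V → Prop) : Prop :=
  ∃ (W : Type u) (_ : Finite W) (_ : Nonempty W) (H : SimpleGraph W), ¬ K W H

/-- The length of the shortest `x`-to-`y` path in `G` with respect to the edge weights `w`.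
(There are finitely many paths in a finite graph, and at least one if `G` is connected.) -/
def pathDist {V : Type u} (G : SimpleGraph V) (w : Sym2 V → ℝ) (x y : V) : ℝ :=
  ⨅ q : G.Path x y, ((q : G.Walk x y).edges.map w).sum

/-- The cost `|S| f + ∑_{x ∈ C} (min_{y ∈ S} d(x, y)) ^ p` of a nonempty set `S` of facilities. -/
def cost {V : Type u} (d : V → V → ℝ) (C : Finset V) (f p : ℝ) (S : Finset V) : ℝ :=
  (S.card : ℝ) * f + ∑ x ∈ C, (⨅ y : {y : V // y ∈ S}, d x y) ^ p

/-- A feasible solution: a nonempty set of facilities, all in the set `F` of allowed locations. -/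
def Feasible {V : Type u} (F S : Finset V) : Prop :=
  S.Nonempty ∧ S ⊆ F

/-- One iteration `S ← S'` of local search: `S'` is a feasible solution that differs from `S` in
at most `s` elements, and its cost is at most `1 - ε / n` times that of `S`. -/
def Step {V : Type u} [DecidableEq V] (F : Finset V) (κ : Finset V → ℝ) (ε : ℝ) (n s : ℕ)
    (S S' : Finset V) : Prop :=
  Feasible F S' ∧ (S \ S').card + (S' \ S).card ≤ s ∧ κ S' ≤ (1 - ε / n) * κ S

/-- `L` is a possible output of local search: it is reached by iterations from some feasible
initial solution, and no further iteration is possible. -/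
def IsOutput {V : Type u} [DecidableEq V] (F : Finset V) (κ : Finset V → ℝ) (ε : ℝ) (n s : ℕ)
    (L : Finset V) : Prop :=
  ∃ S₀ : Finset V, Feasible F S₀ ∧ Relation.ReflTransGen (Step F κ ε n s) S₀ L ∧
    ¬ ∃ S' : Finset V, Step F κ ε n s L S'

/-- Local search stops, whatever its initial solution and whatever choices it makes. -/
def Terminates {V : Type u} [DecidableEq V] (F : Finset V) (κ : Finset V → ℝ) (ε : ℝ)
    (n s : ℕ) : Prop :=
  ¬ ∃ S : ℕ → Finset V, Feasible F (S 0) ∧ ∀ i : ℕ, Step F κ ε n s (S i) (S (i + 1))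

/-- Local search with swaps of size `s` and error parameter `ε`, applied to uniform
uncapacitated facility location (exponent `p`) in the metric completion of any connected
edge-weighted graph of the family `K`, always stops, and each of its outputs that has at most `n`
facilities costs at most `1 + ε` times the minimum. Here `n` is the number in the stopping rule;
`n = |C|` and `n = |V|` are both allowed. -/
def LocalSearchApproximates (K : (V : Type u) → SimpleGraph V → Prop) (p ε : ℝ) (s : ℕ) : Prop :=
  ∀ (V : Type u) [Fintype V] [DecidableEq V] (G : SimpleGraph V) (w : Sym2 V → ℝ)
    (F C : Finset V) (f : ℝ) (n : ℕ),
    K V G → G.Connected → (∀ e ∈ G.edgeSet, 0 ≤ w e) → C.Nonempty → 0 < f →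
    C.card ≤ n → 2 ≤ n →
    Terminates F (cost (pathDist G w) C f p) ε n s ∧
    ∀ L : Finset V, IsOutput F (cost (pathDist G w) C f p) ε n s L → L.card ≤ n →
      ∀ S : Finset V, Feasible F S →
        cost (pathDist G w) C f p L ≤ (1 + ε) * cost (pathDist G w) C f p S

end MinorFacility

end

/-! Compare a local optimum `L` with a solution `S` by cutting the exchange of `L` for `S` into
small swaps. Contracting the Voronoi cells of `L ∪ S` gives a minor of `G` with vertex set `L ∪ S`;
it lies in `K`, so its clique minors have bounded size. The separator theorem (`exists_separator`),
applied recursively (`exists_division`), covers it by regions of at most `s` centres whose sizes sum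
to at most `(1 + O(1/√s)) |L ∪ S|`.

For a region `R`, the solution `mixed` differs from `L` only inside `R`, so local optimality makes
it hardly cheaper than `L`. A shortest path that starts in a cell of `R` and ends at a centre
outside, or the reverse, has an edge where the side changes. Some other region contains both centres
of that edge, so the one in `R` is a boundary centre, and it is no farther from the start than the
end of the path (`exists_boundary`). Hence clients in cells of `R` are served as well as by `S`, all
others as well as by `L`. Summed over all regions, each client gains at least its full change from
`L` to `S` (`sum_client_le`), while the surplus openings number at most three times the overlap of
the regions (`sum_card_mixed_le`). Only single distances are compared, so any increasing power of
them may be summed, and `s` need not depend on `p`.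

The overlap is charged to `f |L ∪ S| ≤ cost L + cost S`, and there are at most `n / 2` regions, so
the slack of the stopping rule costs at most `ε / 2` times `cost L`. This gives `1 + ε` with `s` of
order `1 / ε ^ 2` for every exponent. -/

namespace MinorFacility

/-! ### Connected sets and clique minors -/

variable {V : Type u}

/-- A nonempty set of vertices that no proper nonempty part leaves without an edge to the rest. -/
def ConnSet (G : SimpleGraph V) (T : Finset V) : Prop :=
  T.Nonempty ∧ ∀ D ⊆ T, D.Nonempty → (∀ x ∈ D, ∀ y ∈ T, G.Adj x y → y ∈ D) → T ⊆ D

lemma connSet_singleton (G : SimpleGraph V) (v : V) : ConnSet G {v} := by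
  refine ⟨Finset.singleton_nonempty v, fun D hD hne _ => ?_⟩
  rw [Finset.subset_singleton_iff] at hD
  rcases hD with rfl | rfl
  · simp at hne
  · exact subset_rfl

/-- A set of disjoint connected sets of vertices, any two of them joined by an edge. -/
structure Covey (G : SimpleGraph V) (C : Finset (Finset V)) : Prop where
  conn : ∀ T ∈ C, ConnSet G T
  disj : ∀ T ∈ C, ∀ T' ∈ C, T ≠ T' → Disjoint T T'
  adj : ∀ T ∈ C, ∀ T' ∈ C, T ≠ T' → ∃ x ∈ T, ∃ y ∈ T', G.Adj x y

lemma Covey.subset {G : SimpleGraph V} {C C' : Finset (Finset V)} (h : Covey G C)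
    (hs : C' ⊆ C) : Covey G C' :=
  ⟨fun T hT => h.conn T (hs hT), fun T hT T' hT' => h.disj T (hs hT) T' (hs hT'),
    fun T hT T' hT' => h.adj T (hs hT) T' (hs hT')⟩

variable [DecidableEq V]

lemma ConnSet.insert {G : SimpleGraph V} {T : Finset V} (hT : ConnSet G T) {y z : V}
    (hz : z ∈ T) (h : G.Adj y z) : ConnSet G (insert y T) := by
  refine ⟨Finset.insert_nonempty y T, fun D hD hne hcl => ?_⟩
  have key : (D ∩ T).Nonempty := by
    obtain ⟨x, hx⟩ := hne
    by_cases hxT : x ∈ T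
    · exact ⟨x, Finset.mem_inter.2 ⟨hx, hxT⟩⟩
    · have : x = y := by
        have := hD hx
        simp only [Finset.mem_insert] at this
        tauto
      subst this
      exact ⟨z, Finset.mem_inter.2 ⟨hcl x hx z (Finset.mem_insert_of_mem hz) h, hz⟩⟩
  have hsub : T ⊆ D := by
    have := hT.2 (D ∩ T) Finset.inter_subset_right key (fun a ha b hb hab => by
      simp only [Finset.mem_inter] at ha ⊢
      exact ⟨hcl a ha.1 b (Finset.mem_insert_of_mem hb) hab, hb⟩)
    exact this.trans Finset.inter_subset_left
  intro x hx
  rcases Finset.mem_insert.1 hx with rfl | hx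
  · exact hcl z (hsub hz) x (Finset.mem_insert_self _ _) h.symm
  · exact hsub hx

/-- A connected set avoiding the boundary of a closed set and meeting the closed set
lies inside it. -/
lemma ConnSet.subset_of_closed {G : SimpleGraph V} {T B : Finset V} (hT : ConnSet G T)
    (hne : (T ∩ B).Nonempty) (hcl : ∀ x ∈ T, x ∈ B → ∀ y ∈ T, G.Adj x y → y ∈ B) : T ⊆ B := by
  have := hT.2 (T ∩ B) Finset.inter_subset_left hne (fun x hx y hy hxy => by
    simp only [Finset.mem_inter] at hx ⊢
    exact ⟨hy, hcl x hx.1 hx.2 y hy hxy⟩)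
  exact this.trans Finset.inter_subset_right

lemma ConnSet.induce_connected {G : SimpleGraph V} {T : Finset V} (hT : ConnSet G T) :
    (G.induce (T : Set V)).Connected := by
  classical
  obtain ⟨a, ha⟩ := hT.1
  rw [SimpleGraph.connected_iff_exists_forall_reachable]
  refine ⟨⟨a, ha⟩, ?_⟩
  have := hT.2 (T.filter fun y => ∃ hy : y ∈ (T : Set V),
      (G.induce (T : Set V)).Reachable ⟨a, ha⟩ ⟨y, hy⟩)
    (Finset.filter_subset _ _)
    ⟨a, Finset.mem_filter.2 ⟨ha, ha, SimpleGraph.Reachable.refl _⟩⟩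
    (fun x hx y hy hxy => by
      simp only [Finset.mem_filter] at hx ⊢
      obtain ⟨hxT, hx', hr⟩ := hx
      refine ⟨hy, hy, hr.trans (SimpleGraph.Adj.reachable ?_)⟩
      simpa using hxy)
  rintro ⟨w, hw⟩
  have := this hw
  simp only [Finset.mem_filter] at this
  exact this.2.2

/-- A largest connected set between two given sets absorbs every adjacent admissible vertex. -/
lemma exists_maximal_connSet {G : SimpleGraph V} {T A : Finset V} (hT : ConnSet G T)
    (hTA : T ⊆ A) : ∃ D, ConnSet G D ∧ T ⊆ D ∧ D ⊆ A ∧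
      ∀ x ∈ A, ∀ y ∈ D, G.Adj x y → x ∈ D := by
  classical
  obtain ⟨D, hD, hmax⟩ := Finset.exists_max_image
    (A.powerset.filter fun D => ConnSet G D ∧ T ⊆ D) Finset.card
    ⟨T, by simp [hTA, hT]⟩
  simp only [Finset.mem_filter, Finset.mem_powerset] at hD hmax
  refine ⟨D, hD.2.1, hD.2.2, hD.1, fun x hx y hy hxy => ?_⟩
  by_contra hxD
  have := hmax (insert x D) ⟨Finset.insert_subset hx hD.1, hD.2.1.insert hy hxy,
    hD.2.2.trans (Finset.subset_insert _ _)⟩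
  rw [Finset.card_insert_of_notMem hxD] at this
  omega

/-- Every nonempty set contains a connected component. -/
lemma exists_component (G : SimpleGraph V) {Q : Finset V} (hQ : Q.Nonempty) :
    ∃ D ⊆ Q, ConnSet G D ∧ ∀ x ∈ D, ∀ y ∈ Q, G.Adj x y → y ∈ D := by
  obtain ⟨v, hv⟩ := hQ
  obtain ⟨D, hD, -, hDQ, hcl⟩ := exists_maximal_connSet (connSet_singleton G v)
    (Finset.singleton_subset_iff.2 hv)
  exact ⟨D, hDQ, hD, fun x hx y hy hxy => hcl y hy x hx hxy.symm⟩

/-! ### The separator theorem for graphs without a large clique minor -/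

/-- Either a small connected set meets all of the given sets, or few vertices can be removed such
that each remaining connected set misses one of them. -/
lemma exists_transversal_or_separator (G : SimpleGraph V) (B : Finset V) {k m : ℕ} (hm : 0 < m)
    (A : Fin k → Finset V) :
    (∃ T ⊆ B, ConnSet G T ∧ T.card ≤ m ∧ ∀ i, (T ∩ A i).Nonempty) ∨
    ∃ Z ⊆ B, m * Z.card ≤ (k + 1) * B.card ∧
      ∀ F ⊆ B \ Z, ConnSet G F → ∃ i, Disjoint F (A i) := by
  classical
  by_contra hcon
  push Not at hcon
  obtain ⟨hT, hZ⟩ := hcon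
  -- For fixed `i`, the least `t` with `R i t v` is the size of a smallest connected set through `v`
  -- meeting the first `i` targets. It changes by at most one along an edge of `B`.
  let R : ℕ → ℕ → V → Prop := fun i t v =>
    ∃ T ⊆ B, ConnSet G T ∧ v ∈ T ∧ T.card ≤ t ∧ ∀ j : Fin k, j.val < i → (T ∩ A j).Nonempty
  have hmono : ∀ i t t' v, t ≤ t' → R i t v → R i t' v := by
    rintro i t t' v h ⟨T, h1, h2, h3, h4, h5⟩
    exact ⟨T, h1, h2, h3, h4.trans h, h5⟩
  -- `Z j` collects the vertices where one of these sizes is exactly `j + 1`. For fixed `i` they are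
  -- disjoint for distinct `j`, so some `Z j` with `j < m` is small by averaging.
  let Z : ℕ → Finset V := fun j => B.filter fun v => ∃ i ≤ k, R i (j + 1) v ∧ ¬ R i j v
  let P : ℕ → Finset (ℕ × V) := fun j =>
    (Finset.range (k + 1) ×ˢ B).filter fun q => R q.1 (j + 1) q.2 ∧ ¬ R q.1 j q.2
  have hZP : ∀ j, (Z j).card ≤ (P j).card := by
    intro j
    have : Z j ⊆ (P j).image Prod.snd := by
      intro v hv
      simp only [Z, P, Finset.mem_filter, Finset.mem_image, Finset.mem_product,
        Finset.mem_range] at hv ⊢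
      obtain ⟨hvB, i, hi, h⟩ := hv
      exact ⟨(i, v), ⟨⟨by omega, hvB⟩, h⟩, rfl⟩
    exact (Finset.card_le_card this).trans Finset.card_image_le
  have hPd : ((Finset.range m : Finset ℕ) : Set ℕ).PairwiseDisjoint P := by
    have aux : ∀ a b, a < b → Disjoint (P a) (P b) := by
      intro a b hab
      rw [Finset.disjoint_left]
      intro q hq hq'
      simp only [P, Finset.mem_filter] at hq hq'
      exact hq'.2.2 (hmono _ _ _ _ hab hq.2.1)
    intro a _ b _ hab
    rcases lt_or_gt_of_ne hab with h | h
    · exact aux a b h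
    · exact (aux b a h).symm
  have hsum : ∑ j ∈ Finset.range m, (Z j).card ≤ (k + 1) * B.card := by
    calc ∑ j ∈ Finset.range m, (Z j).card ≤ ∑ j ∈ Finset.range m, (P j).card :=
          Finset.sum_le_sum fun j _ => hZP j
      _ = ((Finset.range m).biUnion P).card := (Finset.card_biUnion hPd).symm
      _ ≤ (Finset.range (k + 1) ×ˢ B).card := Finset.card_le_card (by
          intro q hq
          simp only [P, Finset.mem_biUnion, Finset.mem_filter] at hq
          obtain ⟨_, _, h, _⟩ := hq
          exact h)
      _ = (k + 1) * B.card := by simp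
  obtain ⟨j, hj, hjc⟩ : ∃ j < m, m * (Z j).card ≤ (k + 1) * B.card := by
    by_contra hno
    push Not at hno
    have h1 : ∑ j ∈ Finset.range m, ((k + 1) * B.card) <
        ∑ j ∈ Finset.range m, (m * (Z j).card) :=
      Finset.sum_lt_sum_of_nonempty (by simpa using hm.ne') fun j hj =>
        hno j (Finset.mem_range.1 hj)
    rw [Finset.sum_const, Finset.card_range, smul_eq_mul] at h1
    exact absurd (Nat.mul_le_mul_left m hsum) (not_le.2 (h1.trans_eq (Finset.mul_sum _ _ _).symm))
  obtain ⟨F, hF, hFc, hFA⟩ := hZ (Z j) (Finset.filter_subset _ _) hjc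
  have hnZ : ∀ v ∈ F, ∀ i ≤ k, R i (j + 1) v → R i j v := by
    intro v hv i hi h
    by_contra h'
    have h2 := hF hv
    rw [Finset.mem_sdiff] at h2
    exact h2.2 (Finset.mem_filter.2 ⟨h2.1, i, hi, h, h'⟩)
  have hFB : F ⊆ B := hF.trans Finset.sdiff_subset
  -- Off `Z j`, a size at most `j + 1` is at most `j`. This bound starts at a vertex of `F` in the
  -- next target and spreads along the connected set `F`; for `i = k` it yields a forbidden
  -- transversal.
  have main : ∀ i ≤ k, ∀ v ∈ F, R i j v := by
    intro i
    induction i with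
    | zero =>
      intro _ v hv
      exact hnZ v hv 0 (Nat.zero_le _) ⟨{v}, by simpa using hFB hv, connSet_singleton G v,
        by simp, by simp, by simp⟩
    | succ i ih =>
      intro hi
      have hsub : F ⊆ F.filter fun v => R (i + 1) j v := by
        refine hFc.2 _ (Finset.filter_subset _ _) ?_ ?_
        · have := hFA ⟨i, hi⟩
          rw [Finset.not_disjoint_iff] at this
          obtain ⟨a, haF, haA⟩ := this
          refine ⟨a, Finset.mem_filter.2 ⟨haF, ?_⟩⟩
          obtain ⟨T, h1, h2, h3, h4, h5⟩ := ih (by omega) a haF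
          refine ⟨T, h1, h2, h3, h4, fun l hl => ?_⟩
          rcases Nat.lt_succ_iff_lt_or_eq.1 hl with hl | hl
          · exact h5 l hl
          · have : l = ⟨i, hi⟩ := Fin.ext hl
            subst this
            exact ⟨a, Finset.mem_inter.2 ⟨h3, haA⟩⟩
        · intro x hx y hy hxy
          simp only [Finset.mem_filter] at hx ⊢
          refine ⟨hy, hnZ y hy _ hi ?_⟩
          obtain ⟨_, T, h1, h2, h3, h4, h5⟩ := hx
          refine ⟨insert y T, Finset.insert_subset (hFB hy) h1, h2.insert h3 hxy.symm,
            Finset.mem_insert_self _ _, (Finset.card_insert_le _ _).trans (by omega), ?_⟩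
          intro l hl
          exact (h5 l hl).mono (Finset.inter_subset_inter_right (Finset.subset_insert _ _))
      intro v hv
      exact (Finset.mem_filter.1 (hsub hv)).2
  obtain ⟨v, hv⟩ := hFc.1
  obtain ⟨T, h1, h2, _, h4, h5⟩ := main k le_rfl v hv
  obtain ⟨i, hi⟩ := hT T h1 h2 (by omega)
  have := h5 i i.2
  simp [hi] at this

lemma Covey.insert {G : SimpleGraph V} {C : Finset (Finset V)} (h : Covey G C) {D : Finset V}
    (hD : ConnSet G D) (hdisj : ∀ T ∈ C, Disjoint T D)
    (hadj : ∀ T ∈ C, ∃ x ∈ T, ∃ y ∈ D, G.Adj x y) : Covey G (insert D C) := by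
  refine ⟨?_, ?_, ?_⟩
  · intro T hT
    rcases Finset.mem_insert.1 hT with rfl | hT
    exacts [hD, h.conn T hT]
  · intro T hT T' hT' hne
    rcases Finset.mem_insert.1 hT with h1 | h1 <;> rcases Finset.mem_insert.1 hT' with h2 | h2
    · exact absurd (h1.trans h2.symm) hne
    · exact h1 ▸ (hdisj _ h2).symm
    · exact h2 ▸ hdisj _ h1
    · exact h.disj T h1 T' h2 hne
  · intro T hT T' hT' hne
    rcases Finset.mem_insert.1 hT with h1 | h1 <;> rcases Finset.mem_insert.1 hT' with h2 | h2
    · exact absurd (h1.trans h2.symm) hne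
    · obtain ⟨x, hx, y, hy, hxy⟩ := hadj _ h2
      exact ⟨y, h1 ▸ hy, x, hx, hxy.symm⟩
    · exact h2 ▸ hadj _ h1
    · exact h.adj T h1 T' h2 hne

/-- `B` is a connected component of `U \ X` with more than half of the vertices of `U`. -/
structure BigComponent (G : SimpleGraph V) (U X B : Finset V) : Prop where
  conn : ConnSet G B
  subset : B ⊆ U \ X
  closed : ∀ x ∈ B, ∀ y ∈ U, G.Adj x y → y ∈ B ∨ y ∈ X
  big : U.card < 2 * B.card

/-- The states of the construction of a clique minor in the absence of small separators. -/
structure CoveyState (G : SimpleGraph V) (U : Finset V) (m : ℕ) (C : Finset (Finset V))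
    (X B : Finset V) : Prop where
  covey : Covey G C
  subset : X ⊆ U
  covered : ∀ x ∈ X, ∃ T ∈ C, x ∈ T
  small : ∀ T ∈ C, (X ∩ T).card ≤ m
  disj : ∀ T ∈ C, Disjoint T B
  big : BigComponent G U X B

lemma BigComponent.inter_nonempty {G : SimpleGraph V} {U X B X' B' : Finset V}
    (h : BigComponent G U X B) (h' : BigComponent G U X' B') : (B ∩ B').Nonempty := by
  have h1 : (B ∪ B').card ≤ U.card := Finset.card_le_card
    (Finset.union_subset (h.subset.trans Finset.sdiff_subset)
      (h'.subset.trans Finset.sdiff_subset))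
  have h2 := Finset.card_union_add_card_inter B B'
  have h3 := h.big
  have h4 := h'.big
  rw [← Finset.card_pos]
  omega

/-- Both sets contain more than half of `U`, so they meet; a connected set that avoids `X` and meets
the component `B` cannot leave it. -/
lemma BigComponent.anti {G : SimpleGraph V} {U X B X' B' : Finset V}
    (h : BigComponent G U X B) (h' : BigComponent G U X' B') (hX : X ⊆ X') : B' ⊆ B := by
  refine h'.conn.subset_of_closed (h'.inter_nonempty h) fun x _ hxB y hy hxy => ?_
  have hy' := Finset.mem_sdiff.1 (h'.subset hy)
  rcases h.closed x hxB y hy'.1 hxy with h | h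
  · exact h
  · exact absurd (hX h) hy'.2

lemma CoveyState.card_le {G : SimpleGraph V} {U : Finset V} {m : ℕ} {C : Finset (Finset V)}
    {X B : Finset V} (h : CoveyState G U m C X B) : X.card ≤ C.card * m := by
  have : X ⊆ C.biUnion fun T => X ∩ T := by
    intro x hx
    obtain ⟨T, hT, hxT⟩ := h.covered x hx
    simp only [Finset.mem_biUnion, Finset.mem_inter]
    exact ⟨T, hT, hx, hxT⟩
  exact (Finset.card_le_card this).trans (Finset.card_biUnion_le_card_mul _ _ _ h.small)

/-- A connected set in `B` touching every member enlarges the clique minor. The weight 3 on `B` pays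
for this: with `t = |T| ≥ 1`, the gain in `C` and `X` is at most `1 + t`, less than `3 * t`. -/
lemma CoveyState.add_transversal {G : SimpleGraph V} {U : Finset V} {m : ℕ}
    {C : Finset (Finset V)} {X B T B' : Finset V} (h : CoveyState G U m C X B)
    (hTB : T ⊆ B) (hT : ConnSet G T) (hTm : T.card ≤ m)
    (hadj : ∀ S ∈ C, ∃ x ∈ S, ∃ y ∈ T, G.Adj x y) (hB' : BigComponent G U (X ∪ T) B') :
    CoveyState G U m (insert T C) (X ∪ T) B' ∧
      (insert T C).card + (X ∪ T).card + 3 * B'.card < C.card + X.card + 3 * B.card := by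
  have hBB : B' ⊆ B := h.big.anti hB' Finset.subset_union_left
  have hBU : B ⊆ U := h.big.subset.trans Finset.sdiff_subset
  have hdT : Disjoint T B' := by
    rw [Finset.disjoint_left]
    intro x hx hx'
    have := Finset.mem_sdiff.1 (hB'.subset hx')
    exact this.2 (Finset.mem_union_right _ hx)
  have hXB : ∀ x ∈ X, x ∉ B := fun x hx hxB => (Finset.mem_sdiff.1 (h.big.subset hxB)).2 hx
  constructor
  · refine ⟨h.covey.insert hT (fun S hS => (h.disj S hS).mono_right hTB) hadj,
      Finset.union_subset h.subset (hTB.trans hBU), ?_, ?_, ?_, hB'⟩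
    · intro x hx
      rcases Finset.mem_union.1 hx with hx | hx
      · obtain ⟨S, hS, hxS⟩ := h.covered x hx
        exact ⟨S, Finset.mem_insert_of_mem hS, hxS⟩
      · exact ⟨T, Finset.mem_insert_self _ _, hx⟩
    · intro S hS
      rcases Finset.mem_insert.1 hS with rfl | hS
      · refine (Finset.card_le_card ?_).trans hTm
        exact Finset.inter_subset_right
      · refine (Finset.card_le_card ?_).trans (h.small S hS)
        intro x hx
        simp only [Finset.mem_inter, Finset.mem_union] at hx ⊢
        refine ⟨hx.1.resolve_right fun hxT => ?_, hx.2⟩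
        exact Finset.disjoint_left.1 (h.disj S hS) hx.2 (hTB hxT)
    · intro S hS
      rcases Finset.mem_insert.1 hS with rfl | hS
      · exact hdT
      · exact (h.disj S hS).mono_right hBB
  · have h1 := Finset.card_insert_le T C
    have h2 := Finset.card_union_le X T
    have h3 : T.card + B'.card ≤ B.card := by
      rw [← Finset.card_union_of_disjoint hdT]
      exact Finset.card_le_card (Finset.union_subset hTB hBB)
    have h4 := Finset.card_pos.2 hT.1
    omega

/-- If `T` has no edge to the big component left by `Z`, let `T` absorb what it can reach in `B`
outside that component. Only the part of `Z` inside the enlarged set `D` is then needed to shield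
`D` from the big component, so `X ∩ T` is traded for `Z ∩ D`. -/
lemma CoveyState.cut_off {G : SimpleGraph V} {U : Finset V} {m : ℕ}
    {C : Finset (Finset V)} {X B Z B₁ T : Finset V} (h : CoveyState G U m C X B)
    (hZB : Z ⊆ B) (hZm : Z.card ≤ m) (hB₁ : BigComponent G U (X ∪ Z) B₁) (hT : T ∈ C)
    (hTB₁ : ∀ x ∈ B₁, ∀ y ∈ T, ¬ G.Adj x y)
    (hbig : ∀ Y ⊆ X ∪ Z, ∃ B', BigComponent G U Y B') :
    ∃ C' X' B', CoveyState G U m C' X' B' ∧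
      C'.card + X'.card + 3 * B'.card < C.card + X.card + 3 * B.card := by
  have hB₁B : B₁ ⊆ B := h.big.anti hB₁ Finset.subset_union_left
  have hBU : B ⊆ U := h.big.subset.trans Finset.sdiff_subset
  have hXB : ∀ x ∈ X, x ∉ B := fun x hx hxB => (Finset.mem_sdiff.1 (h.big.subset hxB)).2 hx
  have hTB : ∀ x ∈ T, x ∉ B := fun x hx => Finset.disjoint_left.1 (h.disj T hT) hx
  obtain ⟨D, hD, hTD, hDs, hDcl⟩ := exists_maximal_connSet (h.covey.conn T hT)
    (Finset.subset_union_left (s₂ := B \ B₁))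
  have hDB₁ : ∀ x ∈ D, x ∉ B₁ := by
    intro x hx hx1
    rcases Finset.mem_union.1 (hDs hx) with h1 | h1
    · exact hTB x h1 (hB₁B hx1)
    · exact (Finset.mem_sdiff.1 h1).2 hx1
  have hDB : ∀ x ∈ D, x ∉ T → x ∈ B := by
    intro x hx hxT
    rcases Finset.mem_union.1 (hDs hx) with h1 | h1
    · exact absurd h1 hxT
    · exact (Finset.mem_sdiff.1 h1).1
  obtain ⟨B', hB'⟩ := hbig ((X \ T) ∪ (Z ∩ D))
    (Finset.union_subset_union Finset.sdiff_subset Finset.inter_subset_left)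
  have hB₁B' : B₁ ⊆ B' := hB'.anti hB₁
    (Finset.union_subset_union Finset.sdiff_subset Finset.inter_subset_left)
  -- By maximality of `D`, an edge from `B \ D` into `D` starts in `B₁`. It therefore ends in `Z ∩
  -- D`, which is removed, or in `T`, which has no edge to `B₁`.
  have hB'B : B' ⊆ B \ D := by
    refine hB'.conn.subset_of_closed ?_ ?_
    · obtain ⟨x, hx⟩ := hB₁.conn.1
      exact ⟨x, Finset.mem_inter.2 ⟨hB₁B' hx, Finset.mem_sdiff.2
        ⟨hB₁B hx, fun hxD => hDB₁ x hxD hx⟩⟩⟩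
    · intro x _ hxBD y hyB' hxy
      obtain ⟨hxB, hxD⟩ := Finset.mem_sdiff.1 hxBD
      obtain ⟨hyU, hyX'⟩ := Finset.mem_sdiff.1 (hB'.subset hyB')
      simp only [Finset.mem_union, Finset.mem_sdiff, Finset.mem_inter, not_or] at hyX'
      have hcross : y ∈ D → x ∈ B₁ := by
        intro hyD
        by_contra hx1
        exact hxD (hDcl x (Finset.mem_union_right _ (Finset.mem_sdiff.2 ⟨hxB, hx1⟩)) y hyD hxy)
      rcases h.big.closed x hxB y hyU hxy with hy | hy
      · refine Finset.mem_sdiff.2 ⟨hy, fun hyD => ?_⟩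
        rcases hB₁.closed x (hcross hyD) y hyU hxy with h1 | h1
        · exact hDB₁ y hyD h1
        · rcases Finset.mem_union.1 h1 with h1 | h1
          · exact hXB y h1 hy
          · exact hyX'.2 ⟨h1, hyD⟩
      · have hyT : y ∈ T := by
          by_contra hyT
          exact hyX'.1 ⟨hy, hyT⟩
        exact absurd hxy (hTB₁ x (hcross (hTD hyT)) y hyT)
  have hCe : Covey G (C.erase T) := h.covey.subset (Finset.erase_subset _ _)
  have hcardC : (C.erase T).card + 1 = C.card := Finset.card_erase_add_one hT
  -- If `T` neither absorbs anything from `B` nor covers anything in `X`, the exchange makes no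
  -- progress, but `T` can simply be dropped. Otherwise `|X|` falls by `|X ∩ T|` and rises by at
  -- most `|D ∩ B|`, while `3 * |B|` falls by at least `3 * |D ∩ B|`.
  by_cases hDB0 : (D ∩ B).card = 0 ∧ (X ∩ T).card = 0
  · refine ⟨C.erase T, X, B, ⟨hCe, h.subset, ?_, ?_, ?_, h.big⟩, by omega⟩
    · intro x hx
      obtain ⟨S, hS, hxS⟩ := h.covered x hx
      refine ⟨S, Finset.mem_erase.2 ⟨?_, hS⟩, hxS⟩
      rintro rfl
      have := Finset.card_eq_zero.1 hDB0.2
      exact absurd (Finset.mem_inter.2 ⟨hx, hxS⟩) (by simp [this])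
    · exact fun S hS => h.small S (Finset.mem_of_mem_erase hS)
    · exact fun S hS => h.disj S (Finset.mem_of_mem_erase hS)
  · refine ⟨insert D (C.erase T), (X \ T) ∪ (Z ∩ D), B', ⟨?_, ?_, ?_, ?_, ?_, hB'⟩, ?_⟩
    · refine hCe.insert hD ?_ ?_
      · intro S hS
        rw [Finset.disjoint_left]
        intro x hxS hxD
        have hS' := Finset.mem_erase.1 hS
        have hxT : x ∉ T :=
          Finset.disjoint_left.1 (h.covey.disj S hS'.2 T hT hS'.1) hxS
        exact Finset.disjoint_left.1 (h.disj S hS'.2) hxS (hDB x hxD hxT)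
      · intro S hS
        have hS' := Finset.mem_erase.1 hS
        obtain ⟨x, hx, y, hy, hxy⟩ := h.covey.adj S hS'.2 T hT hS'.1
        exact ⟨x, hx, y, hTD hy, hxy⟩
    · exact Finset.union_subset (Finset.sdiff_subset.trans h.subset)
        ((Finset.inter_subset_left.trans hZB).trans hBU)
    · intro x hx
      rcases Finset.mem_union.1 hx with hx | hx
      · obtain ⟨hxX, hxT⟩ := Finset.mem_sdiff.1 hx
        obtain ⟨S, hS, hxS⟩ := h.covered x hxX
        refine ⟨S, Finset.mem_insert_of_mem (Finset.mem_erase.2 ⟨?_, hS⟩), hxS⟩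
        rintro rfl
        exact hxT hxS
      · exact ⟨D, Finset.mem_insert_self _ _, (Finset.mem_inter.1 hx).2⟩
    · intro S hS
      rcases Finset.mem_insert.1 hS with rfl | hS
      · refine (Finset.card_le_card ?_).trans hZm
        intro x hx
        simp only [Finset.mem_inter, Finset.mem_union, Finset.mem_sdiff] at hx
        rcases hx.1 with h1 | h1
        · exact absurd (hDB x hx.2 h1.2) (hXB x h1.1)
        · exact h1.1
      · have hS' := Finset.mem_erase.1 hS
        refine (Finset.card_le_card ?_).trans (h.small S hS'.2)
        intro x hx
        simp only [Finset.mem_inter, Finset.mem_union, Finset.mem_sdiff] at hx ⊢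
        rcases hx.1 with h1 | h1
        · exact ⟨h1.1, hx.2⟩
        · exact absurd (hZB h1.1) (Finset.disjoint_left.1 (h.disj S hS'.2) hx.2)
    · intro S hS
      rcases Finset.mem_insert.1 hS with rfl | hS
      · exact Finset.disjoint_sdiff.mono_right hB'B
      · exact (h.disj S (Finset.mem_of_mem_erase hS)).mono_right
          (hB'B.trans Finset.sdiff_subset)
    · have h1 := Finset.card_insert_le D (C.erase T)
      have h2 := Finset.card_union_le (X \ T) (Z ∩ D)
      have h3 := Finset.card_sdiff_add_card_inter X T
      have h4 : (Z ∩ D).card ≤ (D ∩ B).card := Finset.card_le_card (by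
        intro x hx
        simp only [Finset.mem_inter] at hx ⊢
        exact ⟨hx.2, hZB hx.1⟩)
      have h5 := Finset.card_le_card hB'B
      have h6 := Finset.card_sdiff_add_card_inter B D
      rw [Finset.inter_comm B D] at h6
      omega

/-- Apply the transversal alternative to the neighbourhoods in `B` of the members: a transversal
extends the clique minor, a separator cuts some member off from the new big component. Since `C.card
+ 1 ≤ h`, there is room for `m` more vertices in `X`, and `h * U.card ≤ m * m` bounds the separator
by `m`. -/
lemma CoveyState.exists_smaller {G : SimpleGraph V} {U : Finset V} {h m : ℕ}
    {C : Finset (Finset V)} {X B : Finset V} (hst : CoveyState G U m C X B)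
    (hno : ∀ C, Covey G C → C.card < h) (hm : h * U.card ≤ m * m)
    (hbig : ∀ X ⊆ U, X.card ≤ h * m → ∃ B, BigComponent G U X B) :
    ∃ C' X' B', CoveyState G U m C' X' B' ∧
      C'.card + X'.card + 3 * B'.card < C.card + X.card + 3 * B.card := by
  classical
  have hk : C.card + 1 ≤ h := hno C hst.covey
  have hX : X.card + m ≤ h * m := by
    calc X.card + m ≤ C.card * m + m := by
          have := hst.card_le
          omega
      _ = (C.card + 1) * m := by ring
      _ ≤ h * m := Nat.mul_le_mul_right _ hk
  have hBU : B ⊆ U := hst.big.subset.trans Finset.sdiff_subset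
  have hUpos : 0 < U.card := by
    have h1 := Finset.card_le_card hBU
    have h2 := Finset.card_pos.2 hst.big.conn.1
    omega
  have hmpos : 0 < m := by
    rcases Nat.eq_zero_or_pos m with rfl | h0
    · have : 0 < h * U.card := Nat.mul_pos (by omega) hUpos
      omega
    · exact h0
  rcases exists_transversal_or_separator G B hmpos
    (fun i : Fin C.card => B.filter fun v => ∃ y ∈ (C.equivFin.symm i : Finset V), G.Adj v y)
    with ⟨T, hTB, hT, hTm, hTA⟩ | ⟨Z, hZB, hZc, hZ⟩
  · obtain ⟨B', hB'⟩ := hbig (X ∪ T) (Finset.union_subset hst.subset (hTB.trans hBU))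
      ((Finset.card_union_le _ _).trans (by omega))
    refine ⟨_, _, _, hst.add_transversal hTB hT hTm ?_ hB'⟩
    intro S hS
    obtain ⟨x, hx⟩ := hTA (C.equivFin ⟨S, hS⟩)
    simp only [Equiv.symm_apply_apply, Finset.mem_inter, Finset.mem_filter] at hx
    obtain ⟨hxT, -, y, hy, hxy⟩ := hx
    exact ⟨y, hy, x, hxT, hxy.symm⟩
  · have hZm : Z.card ≤ m := by
      have h1 : (C.card + 1) * B.card ≤ h * U.card :=
        Nat.mul_le_mul hk (Finset.card_le_card hBU)
      exact Nat.le_of_mul_le_mul_left (hZc.trans (h1.trans hm)) hmpos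
    have hbig' : ∀ Y ⊆ X ∪ Z, ∃ B', BigComponent G U Y B' := by
      intro Y hY
      refine hbig Y (hY.trans (Finset.union_subset hst.subset (hZB.trans hBU))) ?_
      have h1 := Finset.card_le_card hY
      have h2 := Finset.card_union_le X Z
      omega
    obtain ⟨B₁, hB₁⟩ := hbig' _ subset_rfl
    have hB₁B : B₁ ⊆ B := hst.big.anti hB₁ Finset.subset_union_left
    obtain ⟨i, hi⟩ := hZ B₁ (by
      intro x hx
      refine Finset.mem_sdiff.2 ⟨hB₁B hx, fun hxZ => ?_⟩
      exact (Finset.mem_sdiff.1 (hB₁.subset hx)).2 (Finset.mem_union_right _ hxZ)) hB₁.conn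
    refine hst.cut_off hZB hZm hB₁ (C.equivFin.symm i).2 ?_ hbig'
    intro x hx y hy hxy
    exact Finset.disjoint_left.1 hi hx (Finset.mem_filter.2 ⟨hB₁B hx, y, hy, hxy⟩)

/-- The separator theorem of Alon, Seymour and Thomas: if the graph has no clique minor with `h`
vertices, then `h * m` vertices suffice to break `U` into pieces of at most half its size. -/
theorem exists_separator {G : SimpleGraph V} {h m : ℕ} (hno : ∀ C, Covey G C → C.card < h)
    (U : Finset V) (hm : h * U.card ≤ m * m) :
    ∃ X ⊆ U, X.card ≤ h * m ∧ ∀ B ⊆ U \ X, ConnSet G B → 2 * B.card ≤ U.card := by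
  by_contra hcon
  push Not at hcon
  have hbig : ∀ X ⊆ U, X.card ≤ h * m → ∃ B, BigComponent G U X B := by
    intro X hX hXc
    obtain ⟨B₀, hB₀, hc, hlt⟩ := hcon X hX hXc
    obtain ⟨B, hB, hBB, hBs, hcl⟩ := exists_maximal_connSet hc hB₀
    refine ⟨B, hB, hBs, fun x hx y hy hxy => ?_, ?_⟩
    · by_cases hyX : y ∈ X
      · exact Or.inr hyX
      · exact Or.inl (hcl y (Finset.mem_sdiff.2 ⟨hy, hyX⟩) x hx hxy.symm)
    · have := Finset.card_le_card hBB
      omega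
  -- Without a separator the states could descend forever.
  have main : ∀ N : ℕ, ∀ C X B, CoveyState G U m C X B →
      C.card + X.card + 3 * B.card ≤ N → False := by
    intro N
    induction N with
    | zero =>
      intro C X B hst hN
      have := Finset.card_pos.2 hst.big.conn.1
      omega
    | succ N ih =>
      intro C X B hst hN
      obtain ⟨C', X', B', hst', hlt⟩ := hst.exists_smaller hno hm hbig
      exact ih C' X' B' hst' (by omega)
  obtain ⟨B, hB⟩ := hbig ∅ (Finset.empty_subset _) (by simp)
  exact main _ ∅ ∅ B ⟨⟨by simp, by simp, by simp⟩, by simp, by simp, by simp, by simp, hB⟩ le_rfl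

end MinorFacility

/-! ### Recursive division into small regions -/

namespace MinorFacility

variable {V : Type u}

/-- `𝓡` is a family of parts of `U` that covers all vertices and edges inside `U`. -/
structure Division (G : SimpleGraph V) (U : Finset V) (𝓡 : Finset (Finset V)) : Prop where
  subset : ∀ R ∈ 𝓡, R ⊆ U
  vertex : ∀ x ∈ U, ∃ R ∈ 𝓡, x ∈ R
  edge : ∀ x ∈ U, ∀ y ∈ U, G.Adj x y → ∃ R ∈ 𝓡, x ∈ R ∧ y ∈ R

lemma division_singleton (G : SimpleGraph V) (U : Finset V) : Division G U {U} :=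
  ⟨by simp, by simp, fun x hx y hy _ => ⟨U, by simp, hx, hy⟩⟩

variable [DecidableEq V]

/-- Take a largest union of components with at most two thirds of `U`. If the rest is still too big,
adding one of its components `D` overshoots, so `D` has more than a third of `U`; as it has at most
half, `D` alone is balanced. -/
lemma exists_balanced_split {G : SimpleGraph V} {U X : Finset V}
    (hB : ∀ B ⊆ U \ X, ConnSet G B → 2 * B.card ≤ U.card) :
    ∃ P ⊆ U \ X, (∀ x ∈ P, ∀ y ∈ U \ X, G.Adj x y → y ∈ P) ∧ 3 * P.card ≤ 2 * U.card ∧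
      3 * ((U \ X) \ P).card ≤ 2 * U.card := by
  classical
  obtain ⟨P, hP, hmax⟩ := Finset.exists_max_image
    ((U \ X).powerset.filter fun P =>
      (∀ x ∈ P, ∀ y ∈ U \ X, G.Adj x y → y ∈ P) ∧ 3 * P.card ≤ 2 * U.card)
    Finset.card ⟨∅, by simp⟩
  simp only [Finset.mem_filter, Finset.mem_powerset] at hP hmax
  obtain ⟨hPs, hPc, hPn⟩ := hP
  by_cases hQ : 3 * ((U \ X) \ P).card ≤ 2 * U.card
  · exact ⟨P, hPs, hPc, hPn, hQ⟩
  have hQne : ((U \ X) \ P).Nonempty := by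
    rw [← Finset.card_pos]
    omega
  obtain ⟨D, hDs, hD, hDc⟩ := exists_component G hQne
  have hDs' : D ⊆ U \ X := hDs.trans Finset.sdiff_subset
  have hDcl : ∀ x ∈ D, ∀ y ∈ U \ X, G.Adj x y → y ∈ D := by
    intro x hx y hy hxy
    refine hDc x hx y (Finset.mem_sdiff.2 ⟨hy, fun hyP => ?_⟩) hxy
    exact (Finset.mem_sdiff.1 (hDs hx)).2 (hPc y hyP x (hDs' hx) hxy.symm)
  have hdis : Disjoint P D := Finset.disjoint_sdiff.mono_right hDs
  have h1 := hB D hDs' hD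
  have h2 : (U \ X).card ≤ U.card := Finset.card_le_card Finset.sdiff_subset
  have h3 := Finset.card_sdiff_add_card_eq_card hPs
  have h4 := Finset.card_sdiff_add_card_eq_card hDs'
  have h5 := Finset.card_pos.2 hD.1
  have h6 := Finset.card_union_of_disjoint hdis
  have h7 : ¬ 3 * (P ∪ D).card ≤ 2 * U.card := by
    intro h
    have := hmax (P ∪ D) ⟨Finset.union_subset hPs hDs', fun x hx y hy hxy => ?_, h⟩
    · omega
    · rcases Finset.mem_union.1 hx with hx | hx
      · exact Finset.mem_union_left _ (hPc x hx y hy hxy)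
      · exact Finset.mem_union_right _ (hDcl x hx y hy hxy)
  exact ⟨D, hDs', hDcl, by omega, by omega⟩

/-- A graph without a clique minor on `h` vertices is the union of two smaller parts whose overlap
has order the square root of the number of vertices. -/
lemma exists_split {G : SimpleGraph V} {h : ℕ} (hno : ∀ C, Covey G C → C.card < h)
    {U : Finset V} (hU : U.Nonempty) :
    ∃ U₁ U₂ : Finset V, U₁ ∪ U₂ = U ∧
      (U₁.card + U₂.card : ℝ) ≤ U.card + 2 * h ^ 2 * √(U.card) ∧
      (U₁.card : ℝ) ≤ 2 / 3 * U.card + 2 * h ^ 2 * √(U.card) ∧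
      (U₂.card : ℝ) ≤ 2 / 3 * U.card + 2 * h ^ 2 * √(U.card) ∧
      ∀ x ∈ U, ∀ y ∈ U, G.Adj x y → (x ∈ U₁ ∧ y ∈ U₁) ∨ (x ∈ U₂ ∧ y ∈ U₂) := by
  have hh : 1 ≤ h := (Nat.zero_le _).trans_lt (hno ∅ ⟨by simp, by simp, by simp⟩)
  have hh' : (1 : ℝ) ≤ h := by exact_mod_cast hh
  have hn : (1 : ℝ) ≤ U.card := by exact_mod_cast Finset.card_pos.2 hU
  have hs1 : (1 : ℝ) ≤ √(U.card) := Real.one_le_sqrt.2 hn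
  have hsq : √(U.card) * √(U.card) = (U.card : ℝ) := Real.mul_self_sqrt (by linarith)
  -- As `1 ≤ h`, this meets the requirement `h * U.card ≤ m * m`; rounding up at most doubles it.
  let m := ⌈(h : ℝ) * √(U.card)⌉₊
  have hm1 : (h : ℝ) * √(U.card) ≤ m := Nat.le_ceil _
  have hm2 : (m : ℝ) ≤ 2 * h * √(U.card) := by
    have h1 : (m : ℝ) < h * √(U.card) + 1 := Nat.ceil_lt_add_one (by positivity)
    have h2 : 1 * 1 ≤ (h : ℝ) * √(U.card) := mul_le_mul hh' hs1 (by norm_num) (by linarith)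
    linarith
  have hm : h * U.card ≤ m * m := by
    have h1 : ((h : ℝ) * √(U.card)) * (h * √(U.card)) ≤ m * m :=
      mul_le_mul hm1 hm1 (by positivity) (by positivity)
    have h2 : ((h : ℝ) * √(U.card)) * (h * √(U.card)) = h * (h * U.card) := by
      rw [mul_mul_mul_comm, hsq]
      ring
    have h3 : (h : ℝ) * U.card ≤ h * (h * U.card) := by
      have : (0 : ℝ) ≤ h * U.card := by positivity
      nlinarith
    exact_mod_cast (by linarith : (h : ℝ) * U.card ≤ m * m)
  obtain ⟨X, hXU, hXc, hX⟩ := exists_separator hno U hm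
  obtain ⟨P, hPs, hPc, hP3, hQ3⟩ := exists_balanced_split hX
  have hXc' : (X.card : ℝ) ≤ 2 * h ^ 2 * √(U.card) := by
    have h1 : (X.card : ℝ) ≤ h * m := by exact_mod_cast hXc
    have h2 : (h : ℝ) * m ≤ h * (2 * h * √(U.card)) :=
      mul_le_mul_of_nonneg_left hm2 (by linarith)
    calc (X.card : ℝ) ≤ h * (2 * h * √(U.card)) := h1.trans h2
      _ = _ := by ring
  have hP3' : (P.card : ℝ) ≤ 2 / 3 * U.card := by
    have : (3 * P.card : ℝ) ≤ 2 * U.card := by exact_mod_cast hP3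
    linarith
  have hQ3' : (((U \ X) \ P).card : ℝ) ≤ 2 / 3 * U.card := by
    have : (3 * ((U \ X) \ P).card : ℝ) ≤ 2 * U.card := by exact_mod_cast hQ3
    linarith
  have hc1 : ((P ∪ X).card : ℝ) ≤ P.card + X.card := by exact_mod_cast Finset.card_union_le P X
  have hc2 : (((U \ X) \ P ∪ X).card : ℝ) ≤ ((U \ X) \ P).card + X.card := by
    exact_mod_cast Finset.card_union_le _ X
  have hc3 : (((U \ X) \ P).card : ℝ) + P.card + X.card = U.card := by
    have h1 := Finset.card_sdiff_add_card_eq_card hPs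
    have h2 := Finset.card_sdiff_add_card_eq_card hXU
    exact_mod_cast (by omega : ((U \ X) \ P).card + P.card + X.card = U.card)
  refine ⟨P ∪ X, (U \ X) \ P ∪ X, ?_, by linarith, by linarith, by linarith, ?_⟩
  · ext x
    have h1 : x ∈ P → x ∈ U := fun hx => (Finset.mem_sdiff.1 (hPs hx)).1
    have h2 : x ∈ X → x ∈ U := fun hx => hXU hx
    simp only [Finset.mem_union, Finset.mem_sdiff]
    tauto
  · intro x hx y hy hxy
    simp only [Finset.mem_sdiff, Finset.mem_union]
    by_cases hxP : x ∈ P ∧ y ∉ X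
    · exact Or.inl ⟨Or.inl hxP.1, Or.inl (hPc x hxP.1 y (Finset.mem_sdiff.2 ⟨hy, hxP.2⟩) hxy)⟩
    by_cases hyP : y ∈ P ∧ x ∉ X
    · exact Or.inl ⟨Or.inl (hPc y hyP.1 x (Finset.mem_sdiff.2 ⟨hx, hyP.2⟩) hxy.symm),
        Or.inl hyP.1⟩
    tauto

lemma Division.union {G : SimpleGraph V} {U₁ U₂ : Finset V} {𝓡₁ 𝓡₂ : Finset (Finset V)}
    (h₁ : Division G U₁ 𝓡₁) (h₂ : Division G U₂ 𝓡₂)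
    (hE : ∀ x ∈ U₁ ∪ U₂, ∀ y ∈ U₁ ∪ U₂, G.Adj x y → (x ∈ U₁ ∧ y ∈ U₁) ∨ (x ∈ U₂ ∧ y ∈ U₂)) :
    Division G (U₁ ∪ U₂) (𝓡₁ ∪ 𝓡₂) := by
  refine ⟨?_, ?_, ?_⟩
  · intro R hR
    rcases Finset.mem_union.1 hR with h | h
    · exact (h₁.subset R h).trans Finset.subset_union_left
    · exact (h₂.subset R h).trans Finset.subset_union_right
  · intro x hx
    rcases Finset.mem_union.1 hx with h | h
    · obtain ⟨R, hR, hxR⟩ := h₁.vertex x h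
      exact ⟨R, Finset.mem_union_left _ hR, hxR⟩
    · obtain ⟨R, hR, hxR⟩ := h₂.vertex x h
      exact ⟨R, Finset.mem_union_right _ hR, hxR⟩
  · intro x hx y hy hxy
    rcases hE x hx y hy hxy with h | h
    · obtain ⟨R, hR, hxR⟩ := h₁.edge x h.1 y h.2 hxy
      exact ⟨R, Finset.mem_union_left _ hR, hxR⟩
    · obtain ⟨R, hR, hxR⟩ := h₂.edge x h.1 y h.2 hxy
      exact ⟨R, Finset.mem_union_right _ hR, hxR⟩

/-- The numerical heart of the recursion for divisions. -/
lemma recursion_bound {n n₁ n₂ q σ : ℝ} (hn : 0 < n) (hn₁ : 0 ≤ n₁) (hn₂ : 0 ≤ n₂)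
    (hσ : 0 < σ) (hq : 28 * σ ≤ q) (hsum : n ≤ n₁ + n₂) (hsum' : n₁ + n₂ ≤ n + σ * √n)
    (h₁ : n₁ ≤ 3 / 4 * n) (h₂ : n₂ ≤ 3 / 4 * n) :
    (n₁ + 28 * σ * n₁ / q - 14 * σ * √n₁) + (n₂ + 28 * σ * n₂ / q - 14 * σ * √n₂) ≤
      n + 28 * σ * n / q - 14 * σ * √n := by
  have hq0 : 0 < q := by linarith
  have ha : 0 < √n := Real.sqrt_pos.2 hn
  have hsq : √n * √n = n := Real.mul_self_sqrt hn.le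
  -- Since `√(3/4) ≤ 7/8`, the square roots of the two parts sum to at least `8/7 * √n`. The term
  -- `-14 * σ * √n` thus gains `2 * σ * √n`: half pays for the overlap itself, half for its multiple
  -- by `28 * σ / q ≤ 1`.
  have key : ∀ t, 0 ≤ t → t ≤ 3 / 4 * n → 8 / 7 * t ≤ √n * √t := by
    intro t ht htn
    have h1 : √t ≤ 7 / 8 * √n := by
      rw [Real.sqrt_le_left (by positivity)]
      nlinarith
    have h2 : √t * √t = t := Real.mul_self_sqrt ht
    nlinarith [Real.sqrt_nonneg t]
  have hs : 8 / 7 * √n ≤ √n₁ + √n₂ := by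
    have h3 := key n₁ hn₁ h₁
    have h4 := key n₂ hn₂ h₂
    have h5 : √n * (8 / 7 * √n) ≤ √n * (√n₁ + √n₂) := by nlinarith
    exact le_of_mul_le_mul_left h5 ha
  have hα : 28 * σ / q ≤ 1 := (div_le_one hq0).2 hq
  have h6 : 28 * σ / q * (n₁ + n₂ - n) ≤ σ * √n := by
    calc 28 * σ / q * (n₁ + n₂ - n) ≤ 1 * (n₁ + n₂ - n) :=
          mul_le_mul_of_nonneg_right hα (by linarith)
      _ ≤ σ * √n := by linarith
  have h7 : 14 * σ * (8 / 7 * √n) ≤ 14 * σ * (√n₁ + √n₂) :=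
    mul_le_mul_of_nonneg_left hs (by positivity)
  have h8 : 28 * σ * n₁ / q + 28 * σ * n₂ / q - 28 * σ * n / q = 28 * σ / q * (n₁ + n₂ - n) := by
    ring
  linarith

/-- The lower bound `r / 4` makes the potential valid for a single region, where `√r ≤ 2 *
√(U.card)` is needed, and later bounds the number of regions. It survives a split because neither
part exceeds three quarters of `U`. -/
lemma exists_division_aux {G : SimpleGraph V} {h : ℕ} (hno : ∀ C, Covey G C → C.card < h)
    {r : ℕ} (hr : 28 * (2 * (h : ℝ) ^ 2) ≤ √r) (N : ℕ) :
    ∀ U : Finset V, U.card ≤ N → (r : ℝ) / 4 ≤ U.card →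
    ∃ 𝓡, Division G U 𝓡 ∧ (∀ R ∈ 𝓡, R.card ≤ r ∧ (r : ℝ) / 4 ≤ R.card) ∧
      ∑ R ∈ 𝓡, (R.card : ℝ) ≤ U.card + 28 * (2 * (h : ℝ) ^ 2) * U.card / √r
        - 14 * (2 * (h : ℝ) ^ 2) * √(U.card) := by
  have hh : 1 ≤ h := (Nat.zero_le _).trans_lt (hno ∅ ⟨by simp, by simp, by simp⟩)
  have hh' : (1 : ℝ) ≤ h := by exact_mod_cast hh
  set σ : ℝ := 2 * (h : ℝ) ^ 2 with hσdef
  have hσ : 0 < σ := by positivity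
  have hq0 : 0 < √(r : ℝ) := by linarith
  have hr0 : (0 : ℝ) < r := Real.sqrt_pos.1 hq0
  induction N with
  | zero =>
    intro U hU hUr
    have : (U.card : ℝ) = 0 := by exact_mod_cast Nat.le_zero.1 hU
    linarith
  | succ N ih =>
    intro U hU hUr
    have hn0 : (0 : ℝ) < U.card := by linarith
    have ha : 0 < √(U.card : ℝ) := Real.sqrt_pos.2 hn0
    have hsq : √(U.card : ℝ) * √(U.card) = (U.card : ℝ) := Real.mul_self_sqrt hn0.le
    rcases Nat.lt_or_ge r U.card with hlt | hge
    · have hUne : U.Nonempty := Finset.card_pos.1 (by exact_mod_cast hn0)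
      obtain ⟨U₁, U₂, hun, hsum, hc1, hc2, hE⟩ := exists_split hno hUne
      have hqa : √(r : ℝ) ≤ √(U.card) := Real.sqrt_le_sqrt (by exact_mod_cast hlt.le)
      -- The overlap is at most `1/12` of `U`, and `2/3 + 1/12 = 3/4`.
      have h12 : 12 * (σ * √(U.card)) ≤ U.card := by
        have : 12 * σ ≤ √(U.card) := by linarith
        nlinarith
      have hge' : (U.card : ℝ) ≤ U₁.card + U₂.card := by
        have := Finset.card_union_le U₁ U₂
        rw [hun] at this
        exact_mod_cast this
      have h1 : (U₁.card : ℝ) ≤ 3 / 4 * U.card := by linarith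
      have h2 : (U₂.card : ℝ) ≤ 3 / 4 * U.card := by linarith
      have hrU : (r : ℝ) < U.card := by exact_mod_cast hlt
      have hlt1 : U₁.card < U.card := by exact_mod_cast (by linarith : (U₁.card : ℝ) < U.card)
      have hlt2 : U₂.card < U.card := by exact_mod_cast (by linarith : (U₂.card : ℝ) < U.card)
      obtain ⟨𝓡₁, hd1, hs1, ht1⟩ := ih U₁ (by omega) (by linarith)
      obtain ⟨𝓡₂, hd2, hs2, ht2⟩ := ih U₂ (by omega) (by linarith)
      refine ⟨𝓡₁ ∪ 𝓡₂, ?_, ?_, ?_⟩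
      · have := hd1.union hd2 (by rwa [hun])
        rwa [hun] at this
      · intro R hR
        rcases Finset.mem_union.1 hR with h | h
        exacts [hs1 R h, hs2 R h]
      · have h3 : ∑ R ∈ 𝓡₁ ∪ 𝓡₂, (R.card : ℝ) ≤
            ∑ R ∈ 𝓡₁, (R.card : ℝ) + ∑ R ∈ 𝓡₂, (R.card : ℝ) := by
          rw [← Finset.sum_union_inter]
          have : 0 ≤ ∑ R ∈ 𝓡₁ ∩ 𝓡₂, (R.card : ℝ) := Finset.sum_nonneg fun _ _ => by positivity
          linarith
        have h4 := recursion_bound hn0 (Nat.cast_nonneg U₁.card) (Nat.cast_nonneg U₂.card) hσ hr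
          hge' hsum h1 h2
        linarith
    · refine ⟨{U}, division_singleton G U, by simpa using ⟨hge, hUr⟩, ?_⟩
      rw [Finset.sum_singleton]
      have h1 : √(r : ℝ) ≤ 2 * √(U.card) := by
        rw [Real.sqrt_le_left (by positivity)]
        nlinarith
      have h2 : 14 * σ * √(U.card) ≤ 28 * σ * U.card / √r := by
        rw [le_div_iff₀ hq0]
        calc 14 * σ * √(U.card) * √r ≤ 14 * σ * √(U.card) * (2 * √(U.card)) :=
              mul_le_mul_of_nonneg_left h1 (by positivity)
          _ = 28 * σ * (√(U.card) * √(U.card)) := by ring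
          _ = _ := by rw [hsq]
      linarith

/-- Divisions of graphs that exclude a clique minor into regions with at most `r` vertices. -/
theorem exists_division {G : SimpleGraph V} {h : ℕ} (hno : ∀ C, Covey G C → C.card < h)
    {r : ℕ} (hr : 56 * (h : ℝ) ^ 2 ≤ √r) (U : Finset V) :
    ∃ 𝓡, Division G U 𝓡 ∧ (∀ R ∈ 𝓡, R.card ≤ r) ∧
      ∑ R ∈ 𝓡, (R.card : ℝ) ≤ U.card + 56 * (h : ℝ) ^ 2 / √r * U.card ∧
      (𝓡.card = 1 ∨ (𝓡.card : ℝ) * r ≤ 8 * U.card) := by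
  rcases Nat.lt_or_ge r U.card with hlt | hge
  · have hlt' : (r : ℝ) < U.card := by exact_mod_cast hlt
    have hr0 : (0 : ℝ) ≤ r := Nat.cast_nonneg r
    obtain ⟨𝓡, hd, hs, ht⟩ := exists_division_aux hno (r := r) (by linarith) _ U le_rfl
      (by linarith)
    have h1 : 28 * (2 * (h : ℝ) ^ 2) * U.card / √r = 56 * (h : ℝ) ^ 2 / √r * U.card := by ring
    have h2 : 0 ≤ 14 * (2 * (h : ℝ) ^ 2) * √(U.card) := by positivity
    have h3 : 56 * (h : ℝ) ^ 2 / √r * U.card ≤ 1 * U.card :=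
      mul_le_mul_of_nonneg_right (div_le_one_of_le₀ hr (Real.sqrt_nonneg _)) (Nat.cast_nonneg _)
    have h4 : (𝓡.card : ℝ) * (r / 4) ≤ ∑ R ∈ 𝓡, (R.card : ℝ) := by
      rw [← nsmul_eq_mul]
      exact Finset.card_nsmul_le_sum _ _ _ fun R hR => (hs R hR).2
    exact ⟨𝓡, hd, fun R hR => (hs R hR).1, by linarith, Or.inr (by linarith)⟩
  · refine ⟨{U}, division_singleton G U, by simpa using hge, ?_, Or.inl (by simp)⟩
    rw [Finset.sum_singleton]
    have : 0 ≤ 56 * (h : ℝ) ^ 2 / √r * U.card := by positivity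
    linarith

end MinorFacility

/-! ### Shortest paths -/

namespace MinorFacility

section Metric

variable {V : Type u} {G : SimpleGraph V} {w : Sym2 V → ℝ}

lemma walk_length_nonneg (hw : ∀ e ∈ G.edgeSet, 0 ≤ w e) {x y : V} (q : G.Walk x y) :
    0 ≤ (q.edges.map w).sum := by
  refine List.sum_nonneg fun a ha => ?_
  obtain ⟨e, he, rfl⟩ := List.mem_map.1 ha
  exact hw e (q.edges_subset_edgeSet he)

lemma walk_crossing (w : Sym2 V → ℝ) (p : V → Prop) {x y : V} (q : G.Walk x y) (hx : p x)
    (hy : ¬ p y) : ∃ a b, G.Adj a b ∧ p a ∧ ¬ p b ∧ ∃ (q₁ : G.Walk x a) (q₂ : G.Walk b y),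
      (q.edges.map w).sum = (q₁.edges.map w).sum + w s(a, b) + (q₂.edges.map w).sum := by
  induction q with
  | nil => exact absurd hx hy
  | @cons x v y hxv q ih =>
    by_cases hv : p v
    · obtain ⟨a, b, hab, ha, hb, q₁, q₂, h⟩ := ih hv hy
      refine ⟨a, b, hab, ha, hb, SimpleGraph.Walk.cons hxv q₁, q₂, ?_⟩
      simp only [SimpleGraph.Walk.edges_cons, List.map_cons, List.sum_cons, h]
      ring
    · exact ⟨x, v, hxv, hx, hv, SimpleGraph.Walk.nil, q, by simp⟩

lemma exists_adj_of_ne_univ [Fintype V] (hG : G.Connected) {D : Finset V} (hD : D.Nonempty)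
    (hne : D ≠ Finset.univ) : ∃ y ∉ D, ∃ z ∈ D, G.Adj y z := by
  obtain ⟨z, hz⟩ := hD
  obtain ⟨y, hy⟩ : ∃ y, y ∉ D := by
    by_contra h
    push Not at h
    exact hne (Finset.eq_univ_iff_forall.2 h)
  obtain ⟨q⟩ := hG.preconnected y z
  obtain ⟨a, b, hab, ha, hb, -⟩ := walk_crossing 0 (fun v => v ∉ D) q hy (by simpa using hz)
  exact ⟨a, ha, b, by simpa using hb, hab⟩

lemma connected_map (hG : G.Connected) {W : Type*} {φ : V → W}
    (hφ : Function.Surjective φ) : (G.map φ).Connected := by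
  have hwalk : ∀ {x y : V}, G.Walk x y → (G.map φ).Reachable (φ x) (φ y) := by
    intro x y q
    induction q with
    | nil => exact SimpleGraph.Reachable.refl _
    | @cons x v y h q ih =>
      by_cases hxv : φ x = φ v
      · rwa [hxv]
      · exact (SimpleGraph.map_adj_apply' h hxv).reachable.trans ih
  have := hG.nonempty.map φ
  refine ⟨fun a b => ?_⟩
  obtain ⟨x, rfl⟩ := hφ a
  obtain ⟨y, rfl⟩ := hφ b
  obtain ⟨q⟩ := hG.preconnected x y
  exact hwalk q

variable [Fintype V]

lemma finite_path (x y : V) : Finite (G.Path x y) := by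
  classical
  infer_instance

lemma pathDist_le_walk (hw : ∀ e ∈ G.edgeSet, 0 ≤ w e) {x y : V} (q : G.Walk x y) :
    pathDist G w x y ≤ (q.edges.map w).sum := by
  classical
  have := finite_path (G := G) x y
  refine (ciInf_le (Set.finite_range _).bddBelow q.toPath).trans ?_
  refine List.Sublist.sum_le_sum (q.edges_bypass_sublist_edges.map w) ?_
  intro a ha
  obtain ⟨e, he, rfl⟩ := List.mem_map.1 ha
  exact hw e (q.edges_subset_edgeSet he)

lemma exists_walk_eq_pathDist (hG : G.Connected) (w : Sym2 V → ℝ) (x y : V) :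
    ∃ q : G.Walk x y, (q.edges.map w).sum = pathDist G w x y := by
  classical
  have := finite_path (G := G) x y
  obtain ⟨q⟩ := hG.preconnected x y
  have : Nonempty (G.Path x y) := ⟨q.toPath⟩
  obtain ⟨q', hq'⟩ := exists_eq_ciInf_of_finite
    (f := fun q : G.Path x y => ((q : G.Walk x y).edges.map w).sum)
  exact ⟨q', hq'⟩

lemma pathDist_nonneg (hG : G.Connected) (hw : ∀ e ∈ G.edgeSet, 0 ≤ w e) (x y : V) :
    0 ≤ pathDist G w x y := by
  obtain ⟨q, hq⟩ := exists_walk_eq_pathDist hG w x y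
  exact hq ▸ walk_length_nonneg hw q

lemma pathDist_triangle (hG : G.Connected) (hw : ∀ e ∈ G.edgeSet, 0 ≤ w e) (x y z : V) :
    pathDist G w x z ≤ pathDist G w x y + pathDist G w y z := by
  obtain ⟨q, hq⟩ := exists_walk_eq_pathDist hG w x y
  obtain ⟨q', hq'⟩ := exists_walk_eq_pathDist hG w y z
  rw [← hq, ← hq', ← List.sum_append, ← List.map_append, ← SimpleGraph.Walk.edges_append]
  exact pathDist_le_walk hw _

lemma pathDist_le_of_adj (hw : ∀ e ∈ G.edgeSet, 0 ≤ w e) {x y : V} (h : G.Adj x y) :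
    pathDist G w x y ≤ w s(x, y) := by
  simpa using pathDist_le_walk hw (SimpleGraph.Walk.cons h SimpleGraph.Walk.nil)

/-- A shortest path from a vertex with property `p` to one without crosses an edge. -/
lemma exists_crossing (hG : G.Connected) (hw : ∀ e ∈ G.edgeSet, 0 ≤ w e) (p : V → Prop)
    {x y : V} (hx : p x) (hy : ¬ p y) : ∃ a b, G.Adj a b ∧ p a ∧ ¬ p b ∧
      pathDist G w x a + w s(a, b) + pathDist G w b y ≤ pathDist G w x y := by
  obtain ⟨q, hq⟩ := exists_walk_eq_pathDist hG w x y
  obtain ⟨a, b, hab, ha, hb, q₁, q₂, h⟩ := walk_crossing w p q hx hy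
  refine ⟨a, b, hab, ha, hb, ?_⟩
  have h1 := pathDist_le_walk hw q₁
  have h2 := pathDist_le_walk hw q₂
  linarith

end Metric

/-! ### Connected partitions: Voronoi cells and spanning minor models -/

section Extension

variable {V : Type u} [Fintype V] [DecidableEq V] {G : SimpleGraph V}

/-- A partition of part of the vertices into connected sets extends to all vertices. -/
lemma exists_extension {W : Type*} [DecidableEq W] (Q : V → W → Prop) (D₀ : Finset V)
    (φ₀ : V → W) (hfib : ∀ a, ConnSet G (D₀.filter fun x => φ₀ x = a))
    (hQ : ∀ x ∈ D₀, Q x (φ₀ x))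
    (hstep : ∀ D, D₀ ⊆ D → D ≠ Finset.univ →
      ∃ y ∉ D, ∃ z ∈ D, G.Adj y z ∧ ∀ a, Q z a → Q y a) :
    ∃ φ : V → W, (∀ x ∈ D₀, φ x = φ₀ x) ∧
      (∀ a, ConnSet G (Finset.univ.filter fun x => φ x = a)) ∧ ∀ x, Q x (φ x) := by
  -- Take a largest domain that still admits such a partition; any vertex supplied by `hstep` could
  -- join the class of its neighbour.
  classical
  obtain ⟨D, hD, hmax⟩ := Finset.exists_max_image
    ((Finset.univ : Finset (Finset V)).filter fun D => D₀ ⊆ D ∧ ∃ φ : V → W,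
      (∀ x ∈ D₀, φ x = φ₀ x) ∧ (∀ a, ConnSet G (D.filter fun x => φ x = a)) ∧
        ∀ x ∈ D, Q x (φ x)) Finset.card
    ⟨D₀, by
      simp only [Finset.mem_filter, Finset.mem_univ, true_and]
      exact ⟨subset_rfl, φ₀, fun _ _ => rfl, hfib, hQ⟩⟩
  simp only [Finset.mem_filter, Finset.mem_univ, true_and] at hD hmax
  obtain ⟨hDD, φ, h1, h2, h3⟩ := hD
  by_cases hu : D = Finset.univ
  · subst hu
    exact ⟨φ, h1, h2, fun x => h3 x (Finset.mem_univ x)⟩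
  obtain ⟨y, hy, z, hz, hyz, hQa⟩ := hstep D hDD hu
  have hne : ∀ x ∈ D, x ≠ y := fun x hx h => hy (h ▸ hx)
  have hlt := hmax (insert y D) ⟨hDD.trans (Finset.subset_insert _ _),
    Function.update φ y (φ z), ?_, ?_, ?_⟩
  · rw [Finset.card_insert_of_notMem hy] at hlt
    omega
  · intro x hx
    rw [Function.update_of_ne (hne x (hDD hx)), h1 x hx]
  · intro a
    have hcong : D.filter (fun x => Function.update φ y (φ z) x = a) =
        D.filter (fun x => φ x = a) :=
      Finset.filter_congr fun x hx => by rw [Function.update_of_ne (hne x hx)]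
    rw [Finset.filter_insert, Function.update_self, hcong]
    split_ifs with h
    · exact (h2 a).insert (Finset.mem_filter.2 ⟨hz, h⟩) hyz
    · exact h2 a
  · intro x hx
    rcases Finset.mem_insert.1 hx with rfl | hx
    · rw [Function.update_self]
      exact hQa _ (h3 z hz)
    · rw [Function.update_of_ne (hne x hx)]
      exact h3 x hx

/-- Connected Voronoi cells: every vertex can be assigned to a nearest centre such that the set of
vertices assigned to each centre is connected and contains the centre. -/
lemma exists_voronoi {w : Sym2 V → ℝ} (hG : G.Connected) (hw : ∀ e ∈ G.edgeSet, 0 ≤ w e)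
    {U : Finset V} (hU : U.Nonempty) :
    ∃ φ : V → {x // x ∈ U}, (∀ u : {x // x ∈ U}, φ u = u) ∧
      (∀ a, ConnSet G (Finset.univ.filter fun x => φ x = a)) ∧
      ∀ x, ∀ u ∈ U, pathDist G w x (φ x) ≤ pathDist G w x u := by
  obtain ⟨u₀, hu₀⟩ := hU
  let φ₀ : V → {x // x ∈ U} := fun x => if h : x ∈ U then ⟨x, h⟩ else ⟨u₀, hu₀⟩
  have hφ₀ : ∀ x (hx : x ∈ U), φ₀ x = ⟨x, hx⟩ := fun x hx => dif_pos hx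
  have hfib : ∀ a, ConnSet G (U.filter fun x => φ₀ x = a) := by
    intro a
    have : U.filter (fun x => φ₀ x = a) = {a.1} := by
      ext x
      simp only [Finset.mem_filter, Finset.mem_singleton]
      constructor
      · rintro ⟨hx, h⟩
        rw [← h, hφ₀ x hx]
      · rintro rfl
        exact ⟨a.2, hφ₀ _ a.2⟩
    rw [this]
    exact connSet_singleton G _
  have hQ : ∀ x ∈ U, ∀ u ∈ U, pathDist G w x (φ₀ x) ≤ pathDist G w x u := by
    intro x hx u _
    rw [hφ₀ x hx]
    have h0 : pathDist G w x x ≤ 0 := by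
      simpa using pathDist_le_walk hw (SimpleGraph.Walk.nil : G.Walk x x)
    exact h0.trans (pathDist_nonneg hG hw _ _)
  obtain ⟨φ, h1, h2, h3⟩ := exists_extension
    (fun y (a : {x // x ∈ U}) => ∀ u ∈ U, pathDist G w y a ≤ pathDist G w y u) U φ₀ hfib hQ
    (fun D hUD hne => by
      obtain ⟨x, hx⟩ : ∃ x, x ∉ D := by
        by_contra h
        push Not at h
        exact hne (Finset.eq_univ_iff_forall.2 h)
      -- Where a shortest path from `x` to a nearest centre `u` enters `D` by an edge from `a` to
      -- `b`, any centre nearest to `b` is also nearest to `a`. Growing cells this way settles ties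
      -- so that they stay connected.
      obtain ⟨u, hu, hmin⟩ := Finset.exists_min_image U (fun u => pathDist G w x u) ⟨u₀, hu₀⟩
      obtain ⟨a, b, hab, ha, hb, hd⟩ := exists_crossing hG hw (fun v => v ∉ D) hx
        (not_not.2 (hUD hu))
      refine ⟨a, ha, b, not_not.1 hb, hab, fun c hc u' hu' => ?_⟩
      have e1 := hc u hu
      have e2 := hmin u' hu'
      have e3 := pathDist_triangle hG hw x a u'
      have e4 := pathDist_triangle hG hw a b c
      have e5 := pathDist_le_of_adj hw hab
      linarith)
  exact ⟨φ, fun u => by rw [h1 u u.2, hφ₀ _ u.2], h2, h3⟩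

lemma induce_fibre_connected {W : Type*} [DecidableEq W] {φ : V → W} {a : W}
    (h : ConnSet G (Finset.univ.filter fun x => φ x = a)) :
    (G.induce {x : V | φ x = a}).Connected := by
  have := h.induce_connected
  rwa [Finset.coe_filter_univ] at this

lemma isMinor_map {W : Type u} [DecidableEq W] {φ : V → W}
    (h : ∀ a, ConnSet G (Finset.univ.filter fun x => φ x = a)) : IsMinor (G.map φ) G := by
  refine ⟨φ, fun a => induce_fibre_connected (h a), fun a b hab => ?_⟩
  obtain ⟨-, x, y, hxy, hx, hy⟩ := (SimpleGraph.map_adj' _ _ _ _).1 hab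
  exact ⟨x, y, hx, hy, hxy⟩

/-- Members of a minor-closed family have no large clique minors. -/
lemma exists_covey_card_lt {K : (V : Type u) → SimpleGraph V → Prop} (hclosed : MinorClosed K)
    (hnontrivial : NontrivialFamily K) : ∃ h : ℕ, ∀ (V : Type u) [Fintype V] [DecidableEq V]
      (G : SimpleGraph V), K V G → G.Connected → ∀ C, Covey G C → C.card < h := by
  classical
  obtain ⟨W, hfin, hne, H, hH⟩ := hnontrivial
  have := Fintype.ofFinite W
  refine ⟨Fintype.card W, fun V _ _ G hK hG C hC => ?_⟩
  by_contra hlt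
  obtain ⟨f⟩ : Nonempty (W ↪ {T // T ∈ C}) :=
    Function.Embedding.nonempty_of_card_le (by simpa using hlt)
  have huniq : ∀ x a b, x ∈ (f a : Finset V) → x ∈ (f b : Finset V) → a = b := by
    intro x a b ha hb
    by_contra hab
    have hne : (f a : Finset V) ≠ f b := fun h => hab (f.injective (Subtype.ext h))
    exact Finset.disjoint_left.1 (hC.disj _ (f a).2 _ (f b).2 hne) ha hb
  let D₀ : Finset V := Finset.univ.biUnion fun a => (f a : Finset V)
  have hD₀ : ∀ x ∈ D₀, ∃ a, x ∈ (f a : Finset V) := by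
    intro x hx
    simpa [D₀] using hx
  let φ₀ : V → W := fun x => if h : ∃ a, x ∈ (f a : Finset V) then h.choose else hne.some
  have hφ₀ : ∀ x a, x ∈ (f a : Finset V) → φ₀ x = a := by
    intro x a hx
    have h : ∃ a, x ∈ (f a : Finset V) := ⟨a, hx⟩
    simp only [φ₀, dif_pos h]
    exact huniq x _ _ h.choose_spec hx
  have hsub : ∀ a, (f a : Finset V) ⊆ D₀ := fun a =>
    Finset.subset_biUnion_of_mem (fun a => (f a : Finset V)) (Finset.mem_univ a)
  -- Minors here delete no vertices, so the sets of the clique minor must first grow to cover the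
  -- connected graph.
  obtain ⟨φ, h1, h2, -⟩ := exists_extension (G := G) (fun _ _ => True) D₀ φ₀ (fun a => by
    have : D₀.filter (fun x => φ₀ x = a) = f a := by
      ext x
      rw [Finset.mem_filter]
      constructor
      · rintro ⟨hx, hxa⟩
        obtain ⟨b, hb⟩ := hD₀ x hx
        rwa [← hxa, hφ₀ x b hb]
      · exact fun hx => ⟨hsub a hx, hφ₀ x a hx⟩
    rw [this]
    exact hC.conn _ (f a).2) (fun _ _ => trivial) (fun D hD hDne => by
      obtain ⟨a⟩ := hne
      obtain ⟨y, hy, z, hz, hyz⟩ := exists_adj_of_ne_univ hG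
        ((hC.conn _ (f a).2).1.mono ((hsub a).trans hD)) hDne
      exact ⟨y, hy, z, hz, hyz, fun _ _ => trivial⟩)
  have hφ : ∀ a, ∀ x ∈ (f a : Finset V), φ x = a := fun a x hx => by
    rw [h1 x (hsub a hx), hφ₀ x a hx]
  refine hH (hclosed V W G H hK ⟨φ, fun a => induce_fibre_connected (h2 a), fun a b hab => ?_⟩)
  have hne : (f a : Finset V) ≠ f b := fun h => hab.ne (f.injective (Subtype.ext h))
  obtain ⟨x, hx, y, hy, hxy⟩ := hC.adj _ (f a).2 _ (f b).2 hne
  exact ⟨x, y, hφ a x hx, hφ b y hy, hxy⟩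

end Extension

end MinorFacility

/-! ### Costs, and solutions mixed along a region -/

namespace MinorFacility

section Assignment

variable {V : Type u} {d : V → V → ℝ} {S : Finset V} {x : V}

lemma iInf_dist_le {y : V} (hy : y ∈ S) : (⨅ y : {y : V // y ∈ S}, d x y) ≤ d x y :=
  ciInf_le (f := fun y : {y : V // y ∈ S} => d x y) (Set.finite_range _).bddBelow ⟨y, hy⟩

lemma exists_eq_iInf_dist (hS : S.Nonempty) :
    ∃ y ∈ S, d x y = ⨅ y : {y : V // y ∈ S}, d x y := by
  have : Nonempty {y : V // y ∈ S} := hS.to_subtype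
  obtain ⟨y, hy⟩ := exists_eq_ciInf_of_finite (f := fun y : {y : V // y ∈ S} => d x y)
  exact ⟨y, y.2, hy⟩

lemma iInf_dist_nonneg (hd : ∀ x y, 0 ≤ d x y) : 0 ≤ ⨅ y : {y : V // y ∈ S}, d x y :=
  Real.iInf_nonneg fun _ => hd _ _

lemma cost_pos (hd : ∀ x y, 0 ≤ d x y) {C : Finset V} {f p : ℝ} (hf : 0 < f)
    (hS : S.Nonempty) : 0 < cost d C f p S := by
  have h1 : (0 : ℝ) < S.card := by exact_mod_cast Finset.card_pos.2 hS
  have h2 : 0 ≤ ∑ x ∈ C, (⨅ y : {y : V // y ∈ S}, d x y) ^ p :=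
    Finset.sum_nonneg fun _ _ => Real.rpow_nonneg (iInf_dist_nonneg hd) p
  exact add_pos_of_pos_of_nonneg (mul_pos h1 hf) h2

lemma card_mul_le_cost (hd : ∀ x y, 0 ≤ d x y) (C : Finset V) (f p : ℝ) :
    S.card * f ≤ cost d C f p S :=
  le_add_of_nonneg_right
    (Finset.sum_nonneg fun _ _ => Real.rpow_nonneg (iInf_dist_nonneg hd) p)

/-- Some subset with at most `|C|` facilities serves all clients equally well. -/
lemma exists_subset_card_le [DecidableEq V] (hd : ∀ x y, 0 ≤ d x y) {C : Finset V}
    (hC : C.Nonempty) {f p : ℝ} (hf : 0 < f) (hp : 0 < p) (hS : S.Nonempty) :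
    ∃ S' ⊆ S, S'.Nonempty ∧ S'.card ≤ C.card ∧ cost d C f p S' ≤ cost d C f p S := by
  choose g hg hgd using fun x => exists_eq_iInf_dist (d := d) (x := x) hS
  have hsub : C.image g ⊆ S := by
    intro y hy
    obtain ⟨x, -, rfl⟩ := Finset.mem_image.1 hy
    exact hg x
  refine ⟨C.image g, hsub, hC.image g, Finset.card_image_le, add_le_add ?_ ?_⟩
  · exact mul_le_mul_of_nonneg_right (by exact_mod_cast Finset.card_le_card hsub) hf.le
  · refine Finset.sum_le_sum fun x hx => ?_
    refine Real.rpow_le_rpow (iInf_dist_nonneg hd) ?_ hp.le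
    rw [← hgd x]
    exact iInf_dist_le (Finset.mem_image_of_mem g hx)

end Assignment

section Regions

variable {V : Type u} [DecidableEq V]

/-- Vertices are assigned to nearest centres in `U`, and `𝓡` is a family of sets of centres that
covers the adjacency graph of the Voronoi cells. -/
structure VoronoiDivision (G : SimpleGraph V) (d : V → V → ℝ) (U : Finset V) (φ : V → V)
    (𝓡 : Finset (Finset V)) : Prop where
  fixed : ∀ u ∈ U, φ u = u
  nearest : ∀ x, ∀ u ∈ U, d x (φ x) ≤ d x u
  subset : ∀ R ∈ 𝓡, R ⊆ U
  cover : ∀ x, ∃ R ∈ 𝓡, φ x ∈ R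
  edge : ∀ x y, G.Adj x y → ∃ R ∈ 𝓡, φ x ∈ R ∧ φ y ∈ R

/-- The elements of `R` that also belong to another member of the family. -/
def boundary (𝓡 : Finset (Finset V)) (R : Finset V) : Finset V :=
  R ∩ (𝓡.erase R).biUnion id

lemma mem_boundary {𝓡 : Finset (Finset V)} {R : Finset V} {v : V} :
    v ∈ boundary 𝓡 R ↔ v ∈ R ∧ ∃ R' ∈ 𝓡, R' ≠ R ∧ v ∈ R' := by
  simp only [boundary, Finset.mem_inter, Finset.mem_biUnion, Finset.mem_erase, id]
  constructor
  · rintro ⟨h, R', ⟨h1, h2⟩, h3⟩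
    exact ⟨h, R', h2, h1, h3⟩
  · rintro ⟨h, R', h2, h1, h3⟩
    exact ⟨h, R', ⟨h1, h2⟩, h3⟩

/-- The solution that agrees with `S` inside the region `R`, agrees with `L` outside, and has a
facility at each boundary element of the region. -/
def mixed (L S : Finset V) (𝓡 : Finset (Finset V)) (R : Finset V) : Finset V :=
  (L \ R) ∪ (S ∩ R) ∪ boundary 𝓡 R

lemma mem_mixed {L S : Finset V} {𝓡 : Finset (Finset V)} {R : Finset V} {v : V} :
    v ∈ mixed L S 𝓡 R ↔ (v ∈ L ∧ v ∉ R) ∨ (v ∈ S ∧ v ∈ R) ∨ v ∈ boundary 𝓡 R := by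
  simp only [mixed, Finset.mem_union, Finset.mem_sdiff, Finset.mem_inter, or_assoc]

lemma card_mixed_diff_le (L S : Finset V) (𝓡 : Finset (Finset V)) (R : Finset V) :
    (L \ mixed L S 𝓡 R).card + (mixed L S 𝓡 R \ L).card ≤ R.card := by
  rw [← Finset.card_union_of_disjoint disjoint_sdiff_sdiff]
  refine Finset.card_le_card fun v hv => ?_
  simp only [Finset.mem_union, Finset.mem_sdiff, mem_mixed, mem_boundary] at hv
  tauto

lemma card_mixed_le (L S : Finset V) (𝓡 : Finset (Finset V)) (R : Finset V) :
    ((mixed L S 𝓡 R).card : ℝ) ≤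
      L.card - (L ∩ R).card + (S ∩ R).card + (boundary 𝓡 R).card := by
  have h1 := Finset.card_union_le ((L \ R) ∪ (S ∩ R)) (boundary 𝓡 R)
  have h2 := Finset.card_union_le (L \ R) (S ∩ R)
  have h3 : ((L \ R).card : ℝ) + (L ∩ R).card = L.card := by
    exact_mod_cast Finset.card_sdiff_add_card_inter L R
  have h4 : ((mixed L S 𝓡 R).card : ℝ) ≤ (L \ R).card + (S ∩ R).card + (boundary 𝓡 R).card := by
    exact_mod_cast h1.trans (Nat.add_le_add_right h2 _)
  linarith

lemma sum_card_eq_sum_card_filter {U : Finset V} {𝓡 : Finset (Finset V)}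
    {g : Finset V → Finset V} (hg : ∀ R ∈ 𝓡, g R ⊆ U) :
    ∑ R ∈ 𝓡, (g R).card = ∑ u ∈ U, (𝓡.filter fun R => u ∈ g R).card := by
  simp only [Finset.card_filter]
  rw [Finset.sum_comm]
  refine Finset.sum_congr rfl fun R hR => ?_
  rw [← Finset.card_filter, Finset.filter_mem_eq_inter, Finset.inter_eq_right.2 (hg R hR)]

/-- The number of facilities opened in total by all mixed solutions. -/
lemma sum_card_mixed_le {L S : Finset V} {𝓡 : Finset (Finset V)}
    (hsub : ∀ R ∈ 𝓡, R ⊆ L ∪ S) (hcov : ∀ u ∈ L ∪ S, ∃ R ∈ 𝓡, u ∈ R) :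
    ∑ R ∈ 𝓡, (((mixed L S 𝓡 R).card : ℝ) - L.card) ≤
      S.card - L.card + 3 * (∑ R ∈ 𝓡, (R.card : ℝ) - (L ∪ S).card) := by
  let μ : V → ℕ := fun u => (𝓡.filter fun R => u ∈ R).card
  have hμ : ∀ u ∈ L ∪ S, 1 ≤ μ u := by
    intro u hu
    obtain ⟨R, hR, huR⟩ := hcov u hu
    exact Finset.card_pos.2 ⟨R, Finset.mem_filter.2 ⟨hR, huR⟩⟩
  have hR : ∑ R ∈ 𝓡, R.card = ∑ u ∈ L ∪ S, μ u :=
    sum_card_eq_sum_card_filter (g := fun R => R) hsub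
  have hinter : ∀ A : Finset V, ∑ R ∈ 𝓡, (A ∩ R).card = ∑ u ∈ A, μ u := by
    intro A
    rw [sum_card_eq_sum_card_filter (g := fun R => A ∩ R) fun R _ => Finset.inter_subset_left]
    refine Finset.sum_congr rfl fun u hu => ?_
    simp only [Finset.mem_inter, hu, true_and, μ]
  -- An element of `μ` regions lies in no boundary if `μ = 1`, and in at most `μ ≤ 2 * (μ - 1)`
  -- boundaries otherwise.
  have hbd : ∑ R ∈ 𝓡, (boundary 𝓡 R).card ≤ ∑ u ∈ L ∪ S, 2 * (μ u - 1) := by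
    rw [sum_card_eq_sum_card_filter (g := boundary 𝓡) (U := L ∪ S)
      fun R hR => Finset.inter_subset_left.trans (hsub R hR)]
    refine Finset.sum_le_sum fun u _ => ?_
    have h1 : (𝓡.filter fun R => u ∈ boundary 𝓡 R).card ≤ μ u :=
      Finset.card_le_card (Finset.monotone_filter_right _ fun R _ h => (mem_boundary.1 h).1)
    rcases Nat.lt_or_ge (μ u) 2 with h2 | h2
    · have : 𝓡.filter (fun R => u ∈ boundary 𝓡 R) = ∅ := by
        rw [Finset.filter_eq_empty_iff]
        intro R hR hu
        obtain ⟨huR, R', hR', hne, huR'⟩ := mem_boundary.1 hu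
        have : 1 < μ u := Finset.one_lt_card.2
          ⟨R', Finset.mem_filter.2 ⟨hR', huR'⟩, R, Finset.mem_filter.2 ⟨hR, huR⟩, hne⟩
        omega
      simp [this]
    · omega
  have hE : ∀ A ⊆ L ∪ S, (∑ u ∈ A, ((μ u : ℝ) - 1)) ≤ ∑ u ∈ L ∪ S, ((μ u : ℝ) - 1) := by
    intro A hA
    refine Finset.sum_le_sum_of_subset_of_nonneg hA fun u hu _ => ?_
    have : (1 : ℝ) ≤ μ u := by exact_mod_cast hμ u hu
    linarith
  have hsum1 : ∀ A : Finset V, (∑ u ∈ A, ((μ u : ℝ) - 1)) = ∑ u ∈ A, (μ u : ℝ) - A.card := by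
    intro A
    simp [Finset.sum_sub_distrib]
  have hRr : ∑ R ∈ 𝓡, (R.card : ℝ) = ∑ u ∈ L ∪ S, (μ u : ℝ) := by exact_mod_cast hR
  have hLr : ∑ R ∈ 𝓡, ((L ∩ R).card : ℝ) = ∑ u ∈ L, (μ u : ℝ) := by exact_mod_cast hinter L
  have hSr : ∑ R ∈ 𝓡, ((S ∩ R).card : ℝ) = ∑ u ∈ S, (μ u : ℝ) := by exact_mod_cast hinter S
  have hbr : ∑ R ∈ 𝓡, ((boundary 𝓡 R).card : ℝ) ≤ 2 * ∑ u ∈ L ∪ S, ((μ u : ℝ) - 1) := by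
    have h1 : ((∑ R ∈ 𝓡, (boundary 𝓡 R).card : ℕ) : ℝ) ≤
        ((∑ u ∈ L ∪ S, 2 * (μ u - 1) : ℕ) : ℝ) := by exact_mod_cast hbd
    push_cast at h1
    refine h1.trans (le_of_eq ?_)
    rw [Finset.mul_sum]
    refine Finset.sum_congr rfl fun u hu => ?_
    rw [Nat.cast_sub (hμ u hu), Nat.cast_one]
  have hL0 : 0 ≤ ∑ u ∈ L, ((μ u : ℝ) - 1) := Finset.sum_nonneg fun u hu => by
    have : (1 : ℝ) ≤ μ u := by exact_mod_cast hμ u (Finset.mem_union_left _ hu)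
    linarith
  have hS1 := hE S Finset.subset_union_right
  have hmix : ∑ R ∈ 𝓡, (((mixed L S 𝓡 R).card : ℝ) - L.card) ≤
      ∑ R ∈ 𝓡, (((S ∩ R).card : ℝ) + (boundary 𝓡 R).card - (L ∩ R).card) :=
    Finset.sum_le_sum fun R _ => by
      have := card_mixed_le L S 𝓡 R
      linarith
  refine hmix.trans ?_
  rw [Finset.sum_sub_distrib, Finset.sum_add_distrib, hSr, hLr]
  rw [hsum1] at hL0 hS1 hbr
  rw [hsum1] at hS1
  rw [hRr]
  linarith

end Regions

/-! ### Clients under mixed solutions -/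

section Clients

variable {V : Type u} [Fintype V] [DecidableEq V] {G : SimpleGraph V} {w : Sym2 V → ℝ}
  {L S : Finset V} {φ : V → V} {𝓡 : Finset (Finset V)}

/-- On a shortest path from `x` to `y`, let `a` be the end, inside the cells of `R`, of an edge
where the side changes. Its centre is on the boundary, and it is at least as near to `a` as `y` is,
so going to it instead of `y` is no detour. -/
lemma VoronoiDivision.exists_boundary {U : Finset V} (hG : G.Connected)
    (hw : ∀ e ∈ G.edgeSet, 0 ≤ w e) (h : VoronoiDivision G (pathDist G w) U φ 𝓡)
    {R : Finset V} {x y : V} (hy : y ∈ U) (hxy : ¬ (φ x ∈ R ↔ y ∈ R)) :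
    ∃ b ∈ boundary 𝓡 R, pathDist G w x b ≤ pathDist G w x y := by
  have hyφ := h.fixed y hy
  by_cases hx : φ x ∈ R
  · obtain ⟨a, b, hab, ha, hb, hd⟩ := exists_crossing hG hw (fun v => φ v ∈ R) hx
      (show ¬ φ y ∈ R by rw [hyφ]; tauto)
    obtain ⟨R', hR', haR', hbR'⟩ := h.edge a b hab
    refine ⟨φ a, mem_boundary.2 ⟨ha, R', hR', fun he => hb (he ▸ hbR'), haR'⟩, ?_⟩
    have e1 := pathDist_triangle hG hw x a (φ a)
    have e2 := h.nearest a y hy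
    have e3 := pathDist_triangle hG hw a b y
    have e4 := pathDist_le_of_adj hw hab
    linarith
  · obtain ⟨a, b, hab, ha, hb, hd⟩ := exists_crossing hG hw (fun v => φ v ∉ R) hx
      (show ¬ φ y ∉ R by rw [hyφ]; tauto)
    obtain ⟨R', hR', haR', hbR'⟩ := h.edge a b hab
    refine ⟨φ b, mem_boundary.2 ⟨not_not.1 hb, R', hR', fun he => ha (he ▸ haR'), hbR'⟩, ?_⟩
    have e1 := pathDist_triangle hG hw x b (φ b)
    have e2 := h.nearest b y hy
    have e3 := pathDist_triangle hG hw x a b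
    have e4 := pathDist_le_of_adj hw hab
    linarith

lemma VoronoiDivision.exists_mixed_of_mem (hG : G.Connected)
    (hw : ∀ e ∈ G.edgeSet, 0 ≤ w e) (h : VoronoiDivision G (pathDist G w) (L ∪ S) φ 𝓡)
    (hS : S.Nonempty) {R : Finset V} {x : V} (hx : φ x ∈ R) :
    ∃ m ∈ mixed L S 𝓡 R, pathDist G w x m ≤ ⨅ y : {y : V // y ∈ S}, pathDist G w x y := by
  obtain ⟨y, hy, hyd⟩ := exists_eq_iInf_dist (d := pathDist G w) (x := x) hS
  rw [← hyd]
  by_cases hyR : y ∈ R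
  · exact ⟨y, mem_mixed.2 (Or.inr (Or.inl ⟨hy, hyR⟩)), le_rfl⟩
  · obtain ⟨b, hb, hbd⟩ := h.exists_boundary hG hw (Finset.mem_union_right _ hy)
      (show ¬ (φ x ∈ R ↔ y ∈ R) by tauto)
    exact ⟨b, mem_mixed.2 (Or.inr (Or.inr hb)), hbd⟩

lemma VoronoiDivision.exists_mixed_of_notMem (hG : G.Connected)
    (hw : ∀ e ∈ G.edgeSet, 0 ≤ w e) (h : VoronoiDivision G (pathDist G w) (L ∪ S) φ 𝓡)
    (hL : L.Nonempty) {R : Finset V} {x : V} (hx : φ x ∉ R) :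
    ∃ m ∈ mixed L S 𝓡 R, pathDist G w x m ≤ ⨅ y : {y : V // y ∈ L}, pathDist G w x y := by
  obtain ⟨y, hy, hyd⟩ := exists_eq_iInf_dist (d := pathDist G w) (x := x) hL
  rw [← hyd]
  by_cases hyR : y ∈ R
  · obtain ⟨b, hb, hbd⟩ := h.exists_boundary hG hw (Finset.mem_union_left _ hy)
      (show ¬ (φ x ∈ R ↔ y ∈ R) by tauto)
    exact ⟨b, mem_mixed.2 (Or.inr (Or.inr hb)), hbd⟩
  · exact ⟨y, mem_mixed.2 (Or.inl ⟨hy, hyR⟩), le_rfl⟩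

lemma VoronoiDivision.mixed_nonempty (hG : G.Connected)
    (hw : ∀ e ∈ G.edgeSet, 0 ≤ w e) (h : VoronoiDivision G (pathDist G w) (L ∪ S) φ 𝓡)
    (hL : L.Nonempty) (hS : S.Nonempty) (R : Finset V) : (mixed L S 𝓡 R).Nonempty := by
  obtain ⟨x, hxL⟩ := hL
  by_cases hx : φ x ∈ R
  · obtain ⟨m, hm, -⟩ := h.exists_mixed_of_mem hG hw hS hx
    exact ⟨m, hm⟩
  · obtain ⟨m, hm, -⟩ := h.exists_mixed_of_notMem hG hw ⟨x, hxL⟩ hx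
    exact ⟨m, hm⟩

/-- The total change of the connection cost of a client over all mixed solutions. -/
lemma VoronoiDivision.sum_client_le (hG : G.Connected)
    (hw : ∀ e ∈ G.edgeSet, 0 ≤ w e) (h : VoronoiDivision G (pathDist G w) (L ∪ S) φ 𝓡)
    (hL : L.Nonempty) (hS : S.Nonempty) {p : ℝ} (hp : 0 < p) (x : V) :
    ∑ R ∈ 𝓡, ((⨅ y : {y : V // y ∈ mixed L S 𝓡 R}, pathDist G w x y) ^ p -
        (⨅ y : {y : V // y ∈ L}, pathDist G w x y) ^ p) ≤
      (⨅ y : {y : V // y ∈ S}, pathDist G w x y) ^ p -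
        (⨅ y : {y : V // y ∈ L}, pathDist G w x y) ^ p := by
  have hpow : ∀ {R : Finset V} {t : ℝ}, (∃ m ∈ mixed L S 𝓡 R, pathDist G w x m ≤ t) →
      (⨅ y : {y : V // y ∈ mixed L S 𝓡 R}, pathDist G w x y) ^ p ≤ t ^ p := by
    rintro R t ⟨m, hm, hmt⟩
    exact Real.rpow_le_rpow (iInf_dist_nonneg (pathDist_nonneg hG hw))
      ((iInf_dist_le hm).trans hmt) hp.le
  -- One region `R₀` containing the centre of `x` is charged with the change from `L` to `S`. In any
  -- other region containing it, that centre is on the boundary, hence open, and nothing in `L` is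
  -- nearer.
  obtain ⟨R₀, hR₀, hx₀⟩ := h.cover x
  rw [← Finset.add_sum_erase _ _ hR₀]
  have h1 := hpow (h.exists_mixed_of_mem hG hw hS hx₀)
  have h2 : ∑ R ∈ 𝓡.erase R₀, ((⨅ y : {y : V // y ∈ mixed L S 𝓡 R}, pathDist G w x y) ^ p -
      (⨅ y : {y : V // y ∈ L}, pathDist G w x y) ^ p) ≤ 0 := by
    refine Finset.sum_nonpos fun R hR => sub_nonpos.2 (hpow ?_)
    by_cases hx : φ x ∈ R
    · have hb : φ x ∈ boundary 𝓡 R :=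
        mem_boundary.2 ⟨hx, R₀, hR₀, (Finset.ne_of_mem_erase hR).symm, hx₀⟩
      obtain ⟨y, hy, hyd⟩ := exists_eq_iInf_dist (d := pathDist G w) (x := x) hL
      exact ⟨φ x, mem_mixed.2 (Or.inr (Or.inr hb)),
        hyd ▸ h.nearest x y (Finset.mem_union_left _ hy)⟩
    · exact h.exists_mixed_of_notMem hG hw hL hx
  linarith

/-- The total change of cost over all mixed solutions. -/
lemma VoronoiDivision.sum_cost_le (hG : G.Connected)
    (hw : ∀ e ∈ G.edgeSet, 0 ≤ w e) (h : VoronoiDivision G (pathDist G w) (L ∪ S) φ 𝓡)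
    (hL : L.Nonempty) (hS : S.Nonempty) {p f : ℝ} (hp : 0 < p) (hf : 0 < f) (C : Finset V) :
    ∑ R ∈ 𝓡, (cost (pathDist G w) C f p (mixed L S 𝓡 R) - cost (pathDist G w) C f p L) ≤
      cost (pathDist G w) C f p S - cost (pathDist G w) C f p L +
        3 * (∑ R ∈ 𝓡, (R.card : ℝ) - (L ∪ S).card) * f := by
  have h1 := mul_le_mul_of_nonneg_right (sum_card_mixed_le h.subset fun u hu => by
    obtain ⟨R, hR, huR⟩ := h.cover u
    exact ⟨R, hR, by rwa [h.fixed u hu] at huR⟩) hf.le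
  have h2 := Finset.sum_le_sum fun x (_ : x ∈ C) => h.sum_client_le hG hw hL hS hp x
  rw [Finset.sum_comm] at h2
  rw [Finset.sum_mul] at h1
  have h3 := add_le_add h1 h2
  rw [← Finset.sum_add_distrib] at h3
  calc _ = _ := Finset.sum_congr rfl fun R _ => by
        rw [Finset.sum_sub_distrib]
        simp only [cost]
        ring
    _ ≤ _ := h3
    _ = _ := by
        rw [Finset.sum_sub_distrib]
        simp only [cost]
        ring

end Clients

/-! ### Voronoi divisions and the analysis of local search -/

/-- Voronoi divisions into regions of at most `r` centres in members of a minor-closed family. -/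
theorem exists_voronoiDivision {K : (V : Type u) → SimpleGraph V → Prop}
    (hclosed : MinorClosed K) (hnontrivial : NontrivialFamily K) :
    ∃ h : ℕ, ∀ r : ℕ, 56 * (h : ℝ) ^ 2 ≤ √r → ∀ (V : Type u) [Fintype V] [DecidableEq V]
      (G : SimpleGraph V) (w : Sym2 V → ℝ) (U : Finset V), K V G → G.Connected →
      (∀ e ∈ G.edgeSet, 0 ≤ w e) → U.Nonempty →
      ∃ φ 𝓡, VoronoiDivision G (pathDist G w) U φ 𝓡 ∧ (∀ R ∈ 𝓡, R.card ≤ r) ∧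
        ∑ R ∈ 𝓡, (R.card : ℝ) ≤ U.card + 56 * (h : ℝ) ^ 2 / √r * U.card ∧
        (𝓡.card = 1 ∨ (𝓡.card : ℝ) * r ≤ 8 * U.card) := by
  obtain ⟨h, hh⟩ := exists_covey_card_lt hclosed hnontrivial
  refine ⟨h, fun r hr V _ _ G w U hK hG hw hU => ?_⟩
  obtain ⟨φ, hfix, hfib, hnear⟩ := exists_voronoi hG hw hU
  have hsurj : Function.Surjective φ := fun u => ⟨u, hfix u⟩
  -- Contracting the cells stays in `K` and keeps connectedness, so the clique minor bound applies
  -- to the graph on the centres.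
  have hno := hh {x // x ∈ U} (G.map φ) (hclosed _ _ G _ hK (isMinor_map hfib))
    (connected_map hG hsurj)
  obtain ⟨𝓡, hd, hc, hs, hk⟩ := exists_division hno hr Finset.univ
  have hinj : Function.Injective
      (fun R : Finset {x // x ∈ U} => R.map (Function.Embedding.subtype _)) :=
    Finset.map_injective _
  have hmem : ∀ (a : {x // x ∈ U}) (R : Finset {x // x ∈ U}), a ∈ R →
      (a : V) ∈ R.map (Function.Embedding.subtype _) := fun a R ha =>
    Finset.mem_map.2 ⟨a, ha, rfl⟩
  rw [Finset.card_univ, Fintype.card_coe] at hs hk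
  refine ⟨fun x => φ x, 𝓡.map ⟨_, hinj⟩, ⟨fun u hu => ?_, hnear, ?_, ?_, ?_⟩, ?_, ?_, ?_⟩
  · exact congrArg Subtype.val (hfix ⟨u, hu⟩)
  · intro R hR
    obtain ⟨R, -, rfl⟩ := Finset.mem_map.1 hR
    intro x hx
    obtain ⟨a, -, rfl⟩ := Finset.mem_map.1 hx
    exact a.2
  · intro x
    obtain ⟨R, hR, hx⟩ := hd.vertex (φ x) (Finset.mem_univ _)
    exact ⟨_, Finset.mem_map_of_mem _ hR, hmem _ _ hx⟩
  · intro x y hxy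
    by_cases he : φ x = φ y
    · obtain ⟨R, hR, hx⟩ := hd.vertex (φ x) (Finset.mem_univ _)
      exact ⟨_, Finset.mem_map_of_mem _ hR, hmem _ _ hx, hmem _ _ (he ▸ hx)⟩
    · obtain ⟨R, hR, hx, hy⟩ := hd.edge (φ x) (Finset.mem_univ _) (φ y) (Finset.mem_univ _)
        (SimpleGraph.map_adj_apply' hxy he)
      exact ⟨_, Finset.mem_map_of_mem _ hR, hmem _ _ hx, hmem _ _ hy⟩
  · intro R hR
    obtain ⟨R', hR', rfl⟩ := Finset.mem_map.1 hR
    simpa using hc R' hR'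
  · simpa using hs
  · simpa using hk

section LocalSearch

variable {V : Type u} [DecidableEq V] {F : Finset V} {κ : Finset V → ℝ} {ε : ℝ} {n s : ℕ}

lemma terminates_of_pos [Fintype V] (hκ : ∀ S, Feasible F S → 0 < κ S) (hε : 0 < ε)
    (hn : 0 < n) : Terminates F κ ε n s := by
  rintro ⟨S, h0, hS⟩
  have hf : ∀ i, Feasible F (S i) := by
    intro i
    cases i with
    | zero => exact h0
    | succ i => exact (hS i).1
  have hanti : StrictAnti fun i => κ (S i) := by
    refine strictAnti_nat_of_succ_lt fun i => (hS i).2.2.trans_lt ?_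
    have h1 := hκ _ (hf i)
    have h2 : 0 < ε / n := div_pos hε (by exact_mod_cast hn)
    nlinarith
  have hinj : Function.Injective S := fun i j hij => hanti.injective (congrArg κ hij)
  exact not_injective_infinite_finite S hinj

lemma IsOutput.feasible {L : Finset V} (h : IsOutput F κ ε n s L) : Feasible F L := by
  obtain ⟨S₀, h0, hr, -⟩ := h
  rcases Relation.ReflTransGen.cases_tail hr with h | ⟨S, -, h⟩
  · exact h ▸ h0
  · exact h.1

end LocalSearch

/-- Collecting terms leaves `(1 - 3/5 * ε) * x ≤ (1 + ε/10) * y`, and `1 + ε/10 ≤ (1 + ε) * (1 - 3/5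
* ε)` holds because `ε ≤ 1/2`. -/
lemma approximation_arith {x y ε t δ : ℝ} (hx : 0 < x) (hε : 0 < ε) (hε' : ε < 1 / 2)
    (ht : t ≤ ε / 2) (hδ : δ ≤ ε / 30) (hy : 0 ≤ y)
    (h : -(t * x) ≤ y - x + 3 * (δ * (x + y))) : x ≤ (1 + ε) * y := by
  have h1 : t * x ≤ ε / 2 * x := mul_le_mul_of_nonneg_right ht hx.le
  have h2 : δ * (x + y) ≤ ε / 30 * (x + y) := mul_le_mul_of_nonneg_right hδ (by linarith)
  have h3 : x * (1 - 3 / 5 * ε) ≤ y * (1 + ε / 10) := by linarith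
  have h4 : y * (1 + ε / 10) ≤ y * ((1 + ε) * (1 - 3 / 5 * ε)) := by
    refine mul_le_mul_of_nonneg_left ?_ hy
    nlinarith
  have h5 : (1 - 3 / 5 * ε) * x ≤ (1 - 3 / 5 * ε) * ((1 + ε) * y) := by linarith
  exact le_of_mul_le_mul_left h5 (by linarith)

/-- The guarantee of local search for all exponents. -/
theorem exists_localSearchApproximates {K : (V : Type u) → SimpleGraph V → Prop}
    (hclosed : MinorClosed K) (hnontrivial : NontrivialFamily K) :
    ∃ c : ℕ, ∀ p : ℝ, 0 < p → ∀ ε : ℝ, 0 < ε → ε < 1 / 2 →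
      ∀ s : ℕ, ⌊(c : ℝ) / ε ^ 2⌋₊ ≤ s → LocalSearchApproximates K p ε s := by
  obtain ⟨h, hh⟩ := exists_voronoiDivision hclosed hnontrivial
  -- `1680 = 30 * 56` makes the relative overlap at most `ε / 30`. The final `+ 1` absorbs the
  -- floor, and `h ^ 2 + 1` keeps `s` large even for `h = 0`.
  refine ⟨(1680 * (h ^ 2 + 1)) ^ 2 + 1, fun p hp ε hε hε' s hs => ?_⟩
  have hsq : 1680 * ((h : ℝ) ^ 2 + 1) / ε ≤ √s := by
    have h1 := Nat.lt_of_floor_lt (Nat.lt_succ_of_le hs)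
    push_cast at h1
    have h2 : 1 ≤ 1 / ε ^ 2 := by
      rw [le_div_iff₀ (by positivity)]
      nlinarith
    rw [add_div] at h1
    refine Real.le_sqrt_of_sq_le ?_
    rw [div_pow]
    linarith
  have hε1 : (1 : ℝ) ≤ 1 / ε := by
    rw [le_div_iff₀ hε]
    linarith
  have hq : 56 * (h : ℝ) ^ 2 ≤ ε / 30 * √s := by
    rw [div_le_iff₀ hε] at hsq
    linarith
  have hq1 : 56 ≤ √(s : ℝ) := by
    rw [div_le_iff₀ hε] at hsq
    have h0 : 0 ≤ √(s : ℝ) := Real.sqrt_nonneg _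
    have h1 : (0 : ℝ) ≤ (h : ℝ) ^ 2 := by positivity
    nlinarith
  have hs32 : (32 : ℝ) ≤ s := by
    have := Real.mul_self_sqrt (Nat.cast_nonneg (α := ℝ) s)
    nlinarith
  have hsqrt : 56 * (h : ℝ) ^ 2 ≤ √s := hq.trans (by nlinarith)
  have hδ : 56 * (h : ℝ) ^ 2 / √s ≤ ε / 30 := by
    rw [div_le_iff₀ (by linarith)]
    exact hq
  intro V _ _ G w F C f n hK hG hw hC hf hCn hn
  have hd : ∀ x y, 0 ≤ pathDist G w x y := pathDist_nonneg hG hw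
  refine ⟨terminates_of_pos (fun S hS => cost_pos hd hf hS.1) hε (by omega), ?_⟩
  intro L hL hLn S₀ hS₀
  have hLF := hL.feasible
  obtain ⟨-, -, -, hlocal⟩ := hL
  -- Only facilities of `S₀` that serve a client are kept; with at most `n` of them, the number of
  -- regions is controlled by `n`.
  obtain ⟨S, hSS, hS, hSc, hcost⟩ := exists_subset_card_le hd hC hf hp hS₀.1
  have hSF : S ⊆ F := hSS.trans hS₀.2
  have hLpos := cost_pos (C := C) (p := p) hd hf hLF.1
  refine le_trans ?_ (mul_le_mul_of_nonneg_left hcost (by linarith))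
  obtain ⟨φ, 𝓡, hV, hR, hsum, hk⟩ := hh s hsqrt V G w (L ∪ S) hK hG hw
    (hLF.1.mono Finset.subset_union_left)
  have hstep : ∀ R ∈ 𝓡, -(ε / n * cost (pathDist G w) C f p L) ≤
      cost (pathDist G w) C f p (mixed L S 𝓡 R) - cost (pathDist G w) C f p L := by
    intro R hRm
    by_contra hlt
    refine hlocal ⟨mixed L S 𝓡 R, ⟨hV.mixed_nonempty hG hw hLF.1 hS R, fun v hv => ?_⟩,
      (card_mixed_diff_le L S 𝓡 R).trans (hR R hRm), by linarith⟩
    have hU : v ∈ R → v ∈ F := fun hvR => by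
      rcases Finset.mem_union.1 (hV.subset R hRm hvR) with h | h
      exacts [hLF.2 h, hSF h]
    rcases mem_mixed.1 hv with h | h | h
    exacts [hLF.2 h.1, hSF h.1, hU (mem_boundary.1 h).1]
  have hsums := Finset.sum_le_sum hstep
  rw [Finset.sum_const, nsmul_eq_mul] at hsums
  have htotal := hsums.trans (hV.sum_cost_le hG hw hLF.1 hS hp hf C)
  have hn0 : (0 : ℝ) < n := by exact_mod_cast (by omega : 0 < n)
  have hUc : ((L ∪ S).card : ℝ) ≤ L.card + S.card := by exact_mod_cast Finset.card_union_le L S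
  have hδ0 : 0 ≤ 56 * (h : ℝ) ^ 2 / √s := by positivity
  refine approximation_arith (t := 𝓡.card * (ε / n)) (δ := 56 * (h : ℝ) ^ 2 / √s)
    hLpos hε hε' ?_ hδ (cost_pos hd hf hS).le ?_
  · rw [← mul_div_assoc, div_le_iff₀ hn0]
    -- There are at most `n / 2` regions: a single one is allowed by `2 ≤ n`, and otherwise `𝓡.card
    -- * s ≤ 8 * (2 * n)` with `32 ≤ s`.
    rcases hk with hk | hk
    · have : (2 : ℝ) ≤ n := by exact_mod_cast hn
      rw [hk, Nat.cast_one]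
      nlinarith
    · have h1 : (L.card : ℝ) ≤ n := by exact_mod_cast hLn
      have h2 : (S.card : ℝ) ≤ n := by exact_mod_cast hSc.trans hCn
      have h3 : (𝓡.card : ℝ) * 32 ≤ 𝓡.card * s :=
        mul_le_mul_of_nonneg_left hs32 (Nat.cast_nonneg _)
      have h4 : (𝓡.card : ℝ) ≤ n / 2 := by linarith
      calc (𝓡.card : ℝ) * ε ≤ n / 2 * ε := mul_le_mul_of_nonneg_right h4 hε.le
        _ = ε / 2 * n := by ring
  · have h1 := card_mul_le_cost (S := L) hd C f p
    have h2 := card_mul_le_cost (S := S) hd C f p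
    have h3 : (∑ R ∈ 𝓡, (R.card : ℝ) - (L ∪ S).card) * f ≤
        56 * (h : ℝ) ^ 2 / √s * (L ∪ S).card * f :=
      mul_le_mul_of_nonneg_right (by linarith) hf.le
    have h4 : 56 * (h : ℝ) ^ 2 / √s * ((L ∪ S).card * f) ≤ 56 * (h : ℝ) ^ 2 / √s *
        (cost (pathDist G w) C f p L + cost (pathDist G w) C f p S) := by
      refine mul_le_mul_of_nonneg_left ?_ hδ0
      nlinarith
    linarith

end MinorFacility

theorem mainTheorem3 (K : (V : Type u) → SimpleGraph V → Prop)
    (hclosed : MinorFacility.MinorClosed K) (hnontrivial : MinorFacility.NontrivialFamily K) :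
    (∃ c : ℕ, ∀ p : ℝ, 0 < p → ∀ ε : ℝ, 0 < ε → ε < 1 / 2 →
      ∀ s : ℕ, ⌊1 / ε ^ c⌋₊ ≤ s → MinorFacility.LocalSearchApproximates K p ε s) ∧
    (∃ c : ℕ, ∀ ε : ℝ, 0 < ε → ε < 1 / 2 →
      ∀ s : ℕ, ⌊(c : ℝ) / ε ^ 2⌋₊ ≤ s → MinorFacility.LocalSearchApproximates K 1 ε s) := by
  obtain ⟨c, hc⟩ := MinorFacility.exists_localSearchApproximates hclosed hnontrivial
  -- As `ε < 1/2`, `c ≤ 2 ^ c ≤ (1 / ε) ^ c`, so `c / ε ^ 2 ≤ 1 / ε ^ (c + 2)`.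
  refine ⟨⟨c + 2, fun p hp ε hε hε' s hs => hc p hp ε hε hε' s (le_trans ?_ hs)⟩,
    ⟨c, fun ε hε hε' s hs => hc 1 one_pos ε hε hε' s hs⟩⟩
  refine Nat.floor_mono ?_
  rw [pow_add, ← div_div]
  refine div_le_div_of_nonneg_right ?_ (by positivity)
  have h1 : (2 : ℝ) ^ c ≤ (1 / ε) ^ c := by
    refine pow_le_pow_left₀ (by norm_num) ?_ c
    rw [le_div_iff₀ hε]
    linarith
  have h2 : (c : ℝ) ≤ 2 ^ c := by exact_mod_cast Nat.lt_two_pow_self.le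
  rw [one_div_pow] at h1
  linarith
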